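/- Let $M$ be a smooth manifold, $\mathcal{T}M$ its slit tangent bundle with projection $\pi$ (all objects below live over $\mathcal TM$ and are smooth there), and $(M,L)$ a Finsler manifold: $L:TM\to\mathbb R$ is continuous, smooth and positive on $\mathcal TM$, positively homogeneous of degree $1$ on each fibre, and the Finsler metric $g$ on $\pi^{-1}(TM)$, i.e. the fibrewise second derivative of the energy $E=\frac12L^2$, is nondegenerate. Let $\rho:T(\mathcal TM)\to\pi^{-1}(TM)$, $\rho(X)=(u,d\pi(X))$ for $X\in T_u(\mathcal TM)$, let $\gamma:\pi^{-1}(TM)\to T(\mathcal TM)$ be the vertical lift, $\overline\eta(u)=(u,u)$, $J=\gamma\circ\rho$, $\mathcal C=\gamma\overline\eta$. For a linear connection $D$ on $\pi^{-1}(TM)$ put $K(X)=D_X\overline\eta$; $D$ is regular if $T_u(\mathcal TM)=\ker\rho_u\oplus\ker K_u$ for all $u\in\mathcal TM$, and then $\beta=(\rho|_{\ker K})^{-1}$ is its horizontal map. With $\mathbf T(X,Y)=D_X\rho Y-D_Y\rho X-\rho[X,Y]$, its (h)h- and (h)hv-torsions are $Q(\overline X,\overline Y)=\mathbf T(\beta\overline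 X,\beta\overline Y)$ and $T(\overline X,\overline Y)=\mathbf T(\gamma\overline X,\beta\overline Y)$. The semispray and the nonlinear connection associated with a regular $D$ are $\beta\overline\eta$ and $2\beta\circ\rho-I$. The Cartan connection $\nabla$ is the regular connection with $\nabla g=0$, $Q=0$ and $g(T(\overline X,\overline Y),\overline Z)=g(T(\overline X,\overline Z),\overline Y)$; from now on $T$ denotes its (h)hv-torsion. The canonical spray $G$ is the vector field on $\mathcal TM$ with $i_G\,dd_JE=-dE$, and the Barthel connection is $\Gamma=[J,G]$, i.e. $\Gamma(X)=[JX,G]-J[X,G]$. Let $A$ be a scalar 1-form on $\pi^{-1}(TM)$, let $\overline a$ be the section of $\pi^{-1}(TM)$ with $g(\overline a,\overline X)=A(\overline X)$ for all $\overline X$, and let $\overline D$ be the HRF-connection with h-recurrence form $A$: the regular connection, with horizontal map $\overline\beta$ and torsions $\overline Q,\overline T$, such that $\overline D_{\overline\beta\overline X}g=A(\overline X)g$, $\overline D_{\gamma\overline X}g=0$, $\overline Q=0$ and $g(\overline T(\overline X,\overline Y),\overline Z)=g(\overline T(\overline X,\overline Z),\overline Y)$ for all $\overline X,\overline Y,\overline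 Z$. Then: (a) the semispray $\overline G=\overline\beta\,\overline\eta$ associated with $\overline D$ is $$\overline G=G+A(\overline\eta)\,\mathcal C-\tfrac12L^2\,\gamma\overline a;$$ (b) the nonlinear connection $\overline\Gamma=2\overline\beta\circ\rho-I$ associated with $\overline D$ satisfies, for every vector field $X$ on $\mathcal TM$, $$\overline\Gamma(X)=\Gamma(X)+A(\rho X)\,\mathcal C+A(\overline\eta)\,JX-g(\rho X,\overline\eta)\,\gamma\overline a+L^2\,\gamma T(\overline a,\rho X).$$ -/

import Mathlib

open Bundle Set VectorField
open scoped Manifold ContDiff Topology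

namespace FinslerPullback

noncomputable section

variable {E : Type*} [NormedAddCommGroup E] [NormedSpace ℝ E]
  {M : Type*} [TopologicalSpace M] [ChartedSpace E M] [IsManifold 𝓘(ℝ, E) ∞ M]

/-! ### The pullback bundle, `π`-vector fields, vector fields on `TM` -/

variable (E M) in
/-- The projection `π : TM → M`. -/
def proj : ContMDiffMap (𝓘(ℝ, E).tangent) 𝓘(ℝ, E) (TangentBundle 𝓘(ℝ, E) M) M ∞ :=
  ⟨fun u => u.proj, Bundle.contMDiff_proj _⟩

/-- The fibres of the pullback bundle `π⁻¹(TM)`: over `u ∈ TM` sits `T_{π u} M`. -/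
abbrev PiFiber (u : TangentBundle 𝓘(ℝ, E) M) : Type _ :=
  (proj E M *ᵖ (TangentSpace 𝓘(ℝ, E) : M → Type _)) u

instance (u : TangentBundle 𝓘(ℝ, E) M) : AddCommGroup (PiFiber u) :=
  inferInstanceAs (AddCommGroup (TangentSpace 𝓘(ℝ, E) u.proj))

instance (u : TangentBundle 𝓘(ℝ, E) M) : IsTopologicalAddGroup (PiFiber u) :=
  inferInstanceAs (IsTopologicalAddGroup (TangentSpace 𝓘(ℝ, E) u.proj))

instance (u : TangentBundle 𝓘(ℝ, E) M) : ContinuousSMul ℝ (PiFiber u) :=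
  inferInstanceAs (ContinuousSMul ℝ (TangentSpace 𝓘(ℝ, E) u.proj))

/-- The tangent space `T_u(TM)`. -/
abbrev TT (u : TangentBundle 𝓘(ℝ, E) M) : Type _ := TangentSpace (𝓘(ℝ, E).tangent) u

variable (E M) in
/-- The slit tangent bundle: the nonzero tangent vectors. -/
def slit : Set (TangentBundle 𝓘(ℝ, E) M) := {u | u.2 ≠ 0}

/-- The `π`-vector field `Y` is smooth at `u`. -/
def SmoothSecAt (Y : Π u : TangentBundle 𝓘(ℝ, E) M, PiFiber u)
    (u : TangentBundle 𝓘(ℝ, E) M) : Prop :=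
  ContMDiffAt (𝓘(ℝ, E).tangent) ((𝓘(ℝ, E).tangent).prod 𝓘(ℝ, E)) ∞
    (fun v => TotalSpace.mk' E v (Y v)) u

/-- The vector field `X` on `TM` is smooth at `u`. -/
def SmoothVFAt (X : Π u : TangentBundle 𝓘(ℝ, E) M, TT u)
    (u : TangentBundle 𝓘(ℝ, E) M) : Prop :=
  ContMDiffAt (𝓘(ℝ, E).tangent) (𝓘(ℝ, E).tangent).tangent ∞
    (fun v => (⟨v, X v⟩ : TangentBundle (𝓘(ℝ, E).tangent) (TangentBundle 𝓘(ℝ, E) M))) u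

/-- The inclusion of the fibre `T_x M` (a copy of the model space `E`) into `TM`. -/
def fibreIncl (x : M) (w : E) : TangentBundle 𝓘(ℝ, E) M := ⟨x, w⟩

/-- The tangent vector `u`, as an element of the vector space `T_{π u} M` (a copy of `E`). -/
def fibreCoord (u : TangentBundle 𝓘(ℝ, E) M) : E := u.2

/-- The bundle morphism `ρ : T(TM) → π⁻¹(TM)`, `ρ(X) = (u, dπ(X))` for `X ∈ T_u(TM)`. -/
def rho (u : TangentBundle 𝓘(ℝ, E) M) : TT u →L[ℝ] PiFiber u :=
  mfderiv (𝓘(ℝ, E).tangent) 𝓘(ℝ, E) (proj E M) u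

/-- The bundle morphism `γ : π⁻¹(TM) → T(TM)`: `γ(u, w)` is the velocity at `t = 0` of
`t ↦ u + t w`, i.e. the derivative at `u` in the direction `w` of the inclusion of the fibre
`T_{π u} M` into `TM`. -/
def gamma (u : TangentBundle 𝓘(ℝ, E) M) : PiFiber u →L[ℝ] TT u :=
  mfderiv 𝓘(ℝ, E) (𝓘(ℝ, E).tangent) (fibreIncl u.proj) (fibreCoord u)

/-- The fundamental `π`-vector field `η(u) = (u, u)`. -/
def eta (u : TangentBundle 𝓘(ℝ, E) M) : PiFiber u := u.2

/-- The vector `1`-form `J = γ ∘ ρ`. -/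
def J (u : TangentBundle 𝓘(ℝ, E) M) : TT u →L[ℝ] TT u := (gamma u).comp (rho u)

/-- The canonical (Liouville) vector field `𝒞 = γ η`. -/
def liouville (u : TangentBundle 𝓘(ℝ, E) M) : TT u := gamma u (eta u)

/-! ### Linear connections on the pullback bundle -/

variable (E M) in
/-- The type of covariant differentiation operators; `D Y u X` is `D_X Y` at `u`. -/
abbrev Conn : Type _ :=
  (Π u : TangentBundle 𝓘(ℝ, E) M, PiFiber u) →
    (Π u : TangentBundle 𝓘(ℝ, E) M, TT u →L[ℝ] PiFiber u)

/-- The connection map `K(X) = D_X η`. -/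
def connMap (D : Conn E M) (u : TangentBundle 𝓘(ℝ, E) M) : TT u →L[ℝ] PiFiber u := D eta u

/-- A regular connection: a smooth linear connection on `π⁻¹(TM)` over the slit tangent bundle
such that `T_u(TM)` is at each `u ≠ 0` the direct sum of the vertical space `ker ρ` and the
horizontal space `ker K`. -/
structure IsRegular (D : Conn E M) : Prop where
  isCovariantDerivativeOn : IsCovariantDerivativeOn E D (slit E M)
  smooth : ContMDiffCovariantDerivativeOn E ∞ D (slit E M)
  isCompl : ∀ u ∈ slit E M,
    IsCompl (LinearMap.ker (rho u).toLinearMap) (LinearMap.ker (connMap D u).toLinearMap)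

/-- The horizontal map `β = (ρ|_H)⁻¹`, where `H = ker K`. -/
def hmap (D : Conn E M) (u : TangentBundle 𝓘(ℝ, E) M) : PiFiber u →L[ℝ] TT u :=
  (LinearMap.ker (connMap D u).toLinearMap).subtypeL.comp
    ((rho u).comp (LinearMap.ker (connMap D u).toLinearMap).subtypeL).inverse

/-- The classical torsion `𝐓(X, Y) = D_X ρY - D_Y ρX - ρ[X, Y]` of vector fields `X`, `Y`. -/
def torsion (D : Conn E M) (X Y : Π u : TangentBundle 𝓘(ℝ, E) M, TT u)
    (u : TangentBundle 𝓘(ℝ, E) M) : PiFiber u :=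
  D (fun v => rho v (Y v)) u (X u) - D (fun v => rho v (X v)) u (Y u)
    - rho u (mlieBracket (𝓘(ℝ, E).tangent) X Y u)

/-- The (h)h-torsion `Q(X, Y) = 𝐓(βX, βY)`. -/
def hhTorsion (D : Conn E M) (X Y : Π u : TangentBundle 𝓘(ℝ, E) M, PiFiber u)
    (u : TangentBundle 𝓘(ℝ, E) M) : PiFiber u :=
  torsion D (fun v => hmap D v (X v)) (fun v => hmap D v (Y v)) u

/-- The (h)hv-torsion `T(X, Y) = 𝐓(γX, βY)`. -/
def hvTorsion (D : Conn E M) (X Y : Π u : TangentBundle 𝓘(ℝ, E) M, PiFiber u)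
    (u : TangentBundle 𝓘(ℝ, E) M) : PiFiber u :=
  torsion D (fun v => gamma v (X v)) (fun v => hmap D v (Y v)) u

/-- The semispray `β η` associated with a regular connection. -/
def assocSpray (D : Conn E M) (u : TangentBundle 𝓘(ℝ, E) M) : TT u := hmap D u (eta u)

/-- The nonlinear connection `2 β ∘ ρ - I` associated with a regular connection. -/
def assocNonlinear (D : Conn E M) (u : TangentBundle 𝓘(ℝ, E) M) : TT u →L[ℝ] TT u :=
  (2 : ℝ) • (hmap D u).comp (rho u) - ContinuousLinearMap.id ℝ (TT u)

/-! ### Finsler structures -/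

/-- The energy `½ L²`. -/
def energy (L : TangentBundle 𝓘(ℝ, E) M → ℝ) (u : TangentBundle 𝓘(ℝ, E) M) : ℝ :=
  1 / 2 * L u ^ 2

/-- The second derivative at `w` of the restriction of the energy to the vector space `T_x M`. -/
def fibreHessian (L : TangentBundle 𝓘(ℝ, E) M → ℝ) (x : M) (w : E) : E →L[ℝ] E →L[ℝ] ℝ :=
  fderiv ℝ (fderiv ℝ (fun y : E => energy L (fibreIncl x y))) w

/-- The Finsler metric `g`: at `u`, the fibrewise second derivative of the energy. -/
def metric (L : TangentBundle 𝓘(ℝ, E) M → ℝ) (u : TangentBundle 𝓘(ℝ, E) M) :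
    PiFiber u →L[ℝ] PiFiber u →L[ℝ] ℝ :=
  fibreHessian (E := E) L u.proj (fibreCoord u)

/-- `L` is a Finsler structure on `M`. Nondegeneracy of `g` says that `d d_J (½ L²)` has maximal
rank; it holds in particular when `g` is positive definite. -/
structure IsFinsler (L : TangentBundle 𝓘(ℝ, E) M → ℝ) : Prop where
  continuous : Continuous L
  smooth : ContMDiffOn (𝓘(ℝ, E).tangent) 𝓘(ℝ, ℝ) ∞ L (slit E M)
  pos : ∀ u ∈ slit E M, 0 < L u
  homogeneous : ∀ (x : M) (w : TangentSpace 𝓘(ℝ, E) x) (c : ℝ), 0 < c →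
    L ⟨x, c • w⟩ = c * L ⟨x, w⟩
  nondegenerate : ∀ u ∈ slit E M, ∀ v : PiFiber u, (∀ w, metric L u v w = 0) → v = 0

/-- `(D_X g)(Y, Z) = X · g(Y, Z) - g(D_X Y, Z) - g(Y, D_X Z)` for `X ∈ T_u(TM)` and `π`-vector
fields `Y`, `Z`. -/
def covMetric (L : TangentBundle 𝓘(ℝ, E) M → ℝ) (D : Conn E M)
    (u : TangentBundle 𝓘(ℝ, E) M) (X : TT u)
    (Y Z : Π u : TangentBundle 𝓘(ℝ, E) M, PiFiber u) : ℝ :=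
  mvfderiv (𝓘(ℝ, E).tangent) (fun v => metric L v (Y v) (Z v)) u X
    - metric L u (D Y u X) (Z u) - metric L u (Y u) (D Z u X)

/-- The connection `D` has vanishing (h)h-torsion. -/
def HHTorsionFree (D : Conn E M) : Prop :=
  ∀ u ∈ slit E M, ∀ X Y, SmoothSecAt X u → SmoothSecAt Y u → hhTorsion D X Y u = 0

/-- The (h)hv-torsion `T` of `D` satisfies `g(T(X, Y), Z) = g(T(X, Z), Y)`. -/
def HVTorsionSymm (L : TangentBundle 𝓘(ℝ, E) M → ℝ) (D : Conn E M) : Prop :=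
  ∀ u ∈ slit E M, ∀ X Y Z, SmoothSecAt X u → SmoothSecAt Y u → SmoothSecAt Z u →
    metric L u (hvTorsion D X Y u) (Z u) = metric L u (hvTorsion D X Z u) (Y u)

/-- `D` is the Cartan connection of the Finsler structure `L`: the regular connection with `Dg = 0`,
vanishing (h)h-torsion and symmetric (h)hv-torsion. -/
structure IsCartan (L : TangentBundle 𝓘(ℝ, E) M → ℝ) (D : Conn E M) : Prop where
  regular : IsRegular D
  metrical : ∀ u ∈ slit E M, ∀ (X : TT u) (Y Z), SmoothSecAt Y u → SmoothSecAt Z u →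
    covMetric L D u X Y Z = 0
  hhTorsion : HHTorsionFree D
  hvTorsion : HVTorsionSymm L D

/-- A (smooth) scalar `π`-form of degree one on the slit tangent bundle: a fibrewise linear map
sending smooth `π`-vector fields to smooth functions. -/
def IsPiOneForm (A : Π u : TangentBundle 𝓘(ℝ, E) M, PiFiber u →L[ℝ] ℝ) : Prop :=
  ∀ u ∈ slit E M, ∀ Y, SmoothSecAt Y u →
    ContMDiffAt (𝓘(ℝ, E).tangent) 𝓘(ℝ, ℝ) ∞ (fun v => A v (Y v)) u

/-- `D` is the horizontally recurrent Finsler connection with h-recurrence form `A`. -/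
structure IsHRF (L : TangentBundle 𝓘(ℝ, E) M → ℝ)
    (A : Π u : TangentBundle 𝓘(ℝ, E) M, PiFiber u →L[ℝ] ℝ) (D : Conn E M) : Prop where
  regular : IsRegular D
  recurrent : ∀ u ∈ slit E M, ∀ (X : PiFiber u) (Y Z), SmoothSecAt Y u → SmoothSecAt Z u →
    covMetric L D u (hmap D u X) Y Z = A u X * metric L u (Y u) (Z u)
  verticallyParallel : ∀ u ∈ slit E M, ∀ (X : PiFiber u) (Y Z),
    SmoothSecAt Y u → SmoothSecAt Z u → covMetric L D u (gamma u X) Y Z = 0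
  hhTorsion : HHTorsionFree D
  hvTorsion : HVTorsionSymm L D

/-- The `π`-vector field `a` with `g(a, X) = A(X)` for all `X`, i.e. `g⁻¹(A)`. -/
def sharp (L : TangentBundle 𝓘(ℝ, E) M → ℝ)
    (A : Π u : TangentBundle 𝓘(ℝ, E) M, PiFiber u →L[ℝ] ℝ)
    (u : TangentBundle 𝓘(ℝ, E) M) : PiFiber u :=
  (metric L u).inverse (A u)

/-! ### Canonical spray and Barthel connection -/

/-- The `1`-form `d_J E = dE ∘ J`. -/
def dJEnergy (L : TangentBundle 𝓘(ℝ, E) M → ℝ) (u : TangentBundle 𝓘(ℝ, E) M) (X : TT u) : ℝ :=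
  mvfderiv (𝓘(ℝ, E).tangent) (energy L) u (J u X)

/-- The `2`-form `Ω = d d_J E`, on vector fields:
`Ω(X, Y) = X · d_J E(Y) - Y · d_J E(X) - d_J E([X, Y])`. -/
def Omega (L : TangentBundle 𝓘(ℝ, E) M → ℝ) (X Y : Π u : TangentBundle 𝓘(ℝ, E) M, TT u)
    (u : TangentBundle 𝓘(ℝ, E) M) : ℝ :=
  mvfderiv (𝓘(ℝ, E).tangent) (fun v => dJEnergy L v (Y v)) u (X u)
    - mvfderiv (𝓘(ℝ, E).tangent) (fun v => dJEnergy L v (X v)) u (Y u)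
    - dJEnergy L u (mlieBracket (𝓘(ℝ, E).tangent) X Y u)

/-- `G` is the canonical spray: the smooth vector field on the slit tangent bundle with
`i_G Ω = - dE`. -/
structure IsCanonicalSpray (L : TangentBundle 𝓘(ℝ, E) M → ℝ)
    (G : Π u : TangentBundle 𝓘(ℝ, E) M, TT u) : Prop where
  smooth : ∀ u ∈ slit E M, SmoothVFAt G u
  eq : ∀ u ∈ slit E M, ∀ Y, SmoothVFAt Y u →
    Omega L G Y u = - mvfderiv (𝓘(ℝ, E).tangent) (energy L) u (Y u)

/-- The Barthel connection `Γ = [J, G]` of a Finsler manifold with canonical spray `G`, as an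
operator on vector fields: `[J, G] X = [J X, G] - J [X, G]`. -/
def barthel (G X : Π u : TangentBundle 𝓘(ℝ, E) M, TT u)
    (u : TangentBundle 𝓘(ℝ, E) M) : TT u :=
  mlieBracket (𝓘(ℝ, E).tangent) (fun v => J v (X v)) G u
    - J u (mlieBracket (𝓘(ℝ, E).tangent) X G u)

end

end FinslerPullback

/-! In a bundle chart of `TM` with coordinates (x, y), everything becomes calculus for one function
e(x, y), the energy. Here `rho` is the first projection, `gamma` the second inclusion and g the
y-Hessian of e. A regular connection has horizontal lifts i ↦ (i, -N i) and horizontal Christoffel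
symbols Γ(i, j). For an HRF-connection, Q = 0 makes Γ symmetric, the vanishing of D η along
horizontal vectors gives Γ(i, y) = N i, and h-recurrence is a metric identity with right-hand side
A(i) g(j, k). These three facts form `IsRecurrentAt`.

The proof is then Koszul's trick. The recurrence identities for (i, y, k), (y, i, k), (k, i, y),
combined with signs +, +, -, isolate g(N i, k), except for a term C(i, k, N y), where C is the third
y-derivative of e (`IsRecurrentAt.koszul`). Euler's relation for e shows that C vanishes as soon as
one argument is y. So i = y gives N y outright, which is the semispray formula
(`IsRecurrentAt.semispray`); substituting this N y back gives N.

The canonical spray is (y, S) with S determined by g(S, k) = e_x(k) - e_xy(y; k), and the Barthel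
connection involves only the fibre derivative of S. Differentiating the equation for S along the
fibre (`IsEnergyAt.fderiv_spray`) produces the A-free part of the formula for -2N, together with a
term C(i, k, S) that cancels. What remains of C(i, k, N y) is C(i, k, a) multiplied by the energy,
and `connForm_gamma_of_metrical` identifies C(i, k, a) with 2 g(T(a, i), k): this is the torsion
term in (b) (`IsRecurrentAt.nonlinear`). -/

namespace FinslerPullback

/-! ### Bundle charts of `TM` and the induced coordinates on `π⁻¹(TM)` and `T(TM)` -/

section Chart

variable {E : Type*} [NormedAddCommGroup E] [NormedSpace ℝ E]
  {M : Type*} [TopologicalSpace M] [ChartedSpace E M] [IsManifold 𝓘(ℝ, E) ∞ M]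

/-- The bundle chart of `TM` at `p`. -/
noncomputable def tchart (p : TangentBundle 𝓘(ℝ, E) M) :
    PartialEquiv (TangentBundle 𝓘(ℝ, E) M) (E × E) :=
  extChartAt (𝓘(ℝ, E).tangent) p

/-- The derivative of the bundle chart of `TM` at `p`. -/
noncomputable def dchart (p u : TangentBundle 𝓘(ℝ, E) M) : TT u →L[ℝ] E × E :=
  mfderiv (𝓘(ℝ, E).tangent) 𝓘(ℝ, E × E) (tchart p) u

/-- The trivialization of `π⁻¹(TM)` over the bundle chart at `p`, on the fibre over `u`. -/
noncomputable def dfib (p u : TangentBundle 𝓘(ℝ, E) M) : PiFiber u →L[ℝ] E :=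
  (trivializationAt E (TangentSpace 𝓘(ℝ, E)) p.proj).continuousLinearMapAt ℝ u.proj

/-- The constant section of `π⁻¹(TM)` with value `v` over the bundle chart at `p`. -/
noncomputable def constSec (p : TangentBundle 𝓘(ℝ, E) M) (v : E)
    (u : TangentBundle 𝓘(ℝ, E) M) : PiFiber u :=
  (trivializationAt E (TangentSpace 𝓘(ℝ, E)) p.proj).symmL ℝ u.proj v

variable {p u : TangentBundle 𝓘(ℝ, E) M}

theorem mem_tchart_source : u ∈ (tchart p).source ↔ u.proj ∈ (chartAt E p.proj).source := by
  simp [tchart]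

theorem tchart_snd : (tchart p u).2 =
    (trivializationAt E (TangentSpace 𝓘(ℝ, E)) p.proj u).2 := rfl

theorem tchart_snd_eq (hu : u ∈ (tchart p).source) : (tchart p u).2 = dfib p u (eta u) := by
  rw [tchart_snd, dfib]
  have := (trivializationAt E (TangentSpace 𝓘(ℝ, E)) p.proj).continuousLinearMapAt_apply_of_mem
    (R := ℝ) (b := u.proj)
    (by simpa using mem_tchart_source.1 hu) u.2
  exact this.symm

theorem dfib_eq_mfderiv (hu : u ∈ (tchart p).source) :
    dfib p u = mfderiv 𝓘(ℝ, E) 𝓘(ℝ, E) (extChartAt 𝓘(ℝ, E) p.proj) u.proj :=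
  TangentBundle.continuousLinearMapAt_trivializationAt (mem_tchart_source.1 hu)

theorem mdifferentiableAt_tchart (hu : u ∈ (tchart p).source) :
    MDifferentiableAt (𝓘(ℝ, E).tangent) 𝓘(ℝ, E × E) (tchart p) u :=
  mdifferentiableAt_extChartAt (by simpa [tchart] using hu)

theorem dfib_rho (hu : u ∈ (tchart p).source) (X : TT u) :
    dfib p u (rho u X) = (dchart p u X).1 := by
  have h1 := mem_tchart_source.1 hu
  have h3 : MDifferentiableAt (𝓘(ℝ, E).tangent) 𝓘(ℝ, E) (proj E M) u :=
    (proj E M).contMDiff.mdifferentiableAt (by simp)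
  have h4 : MDifferentiableAt 𝓘(ℝ, E) 𝓘(ℝ, E) (extChartAt 𝓘(ℝ, E) p.proj) (proj E M u) :=
    mdifferentiableAt_extChartAt h1
  have h5 := mfderiv_comp (I := 𝓘(ℝ, E).tangent) u h4 h3
  have h6 : HasMFDerivAt 𝓘(ℝ, E × E) 𝓘(ℝ, E) (Prod.fst : E × E → E) (tchart p u)
    (ContinuousLinearMap.fst ℝ E E) := (hasFDerivAt_fst (𝕜 := ℝ)).hasMFDerivAt
  have h7 := (h6.comp u (mdifferentiableAt_tchart hu).hasMFDerivAt).mfderiv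
  have h8 := h5.symm.trans h7
  rw [dfib_eq_mfderiv hu]
  exact congr($h8 X)

theorem tchart_fibreIncl (hu : u ∈ (tchart p).source) (w : E) :
    tchart p (fibreIncl u.proj w) = ((tchart p u).1, (show E →L[ℝ] E from dfib p u) w) :=
  Prod.ext rfl <| tchart_snd_eq (p := p) (u := fibreIncl u.proj w)
    (mem_tchart_source.2 (mem_tchart_source.1 hu))

/-- The bundle chart is linear on each fibre, with linear part `dfib p u`, and does not move the
base point; so differentiating along the fibre returns this linear map itself. -/
theorem dchart_gamma (hu : u ∈ (tchart p).source) (w : PiFiber u) :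
    dchart p u (gamma u w) = (0, dfib p u w) := by
  have h1 := mem_tchart_source.1 hu
  have h4 := tchart_fibreIncl hu
  have h5 : HasMFDerivAt 𝓘(ℝ, E) 𝓘(ℝ, E × E) ((tchart p) ∘ (fibreIncl u.proj)) (fibreCoord u)
     ((0 : E →L[ℝ] E).prod (show E →L[ℝ] E from dfib p u)) := by
    rw [show (tchart p) ∘ (fibreIncl u.proj) = _ from funext h4]
    exact ((hasFDerivAt_const _ _).prodMk
      (show E →L[ℝ] E from dfib p u).hasFDerivAt).hasMFDerivAt
  have h2 : MDifferentiableAt 𝓘(ℝ, E) (𝓘(ℝ, E).tangent) (fibreIncl (M := M) u.proj)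
      (fibreCoord u) := by
    have h6 : fibreIncl u.proj (fibreCoord u) ∈ (chartAt (ModelProd E E) p).source := by
      simpa [fibreIncl] using h1
    -- Differentiability is tested in the chart at `p`, where the fibre inclusion is the affine map
    -- of `h5`.
    rw [mdifferentiableAt_iff_target_of_mem_source h6]
    refine ⟨(FiberBundle.continuous_totalSpaceMk E (TangentSpace 𝓘(ℝ, E)) u.proj).continuousAt,
      h5.mdifferentiableAt⟩
  have h3 := mfderiv_comp (I := 𝓘(ℝ, E)) (fibreCoord u) (g := tchart p)
    (mdifferentiableAt_tchart hu) h2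
  have h6 := h3.symm.trans h5.mfderiv
  exact congr($h6 w)

theorem dfib_constSec (hu : u ∈ (tchart p).source) (v : E) : dfib p u (constSec p v u) = v := by
  exact (trivializationAt E (TangentSpace 𝓘(ℝ, E)) p.proj).continuousLinearMapAt_symmL
    (R := ℝ) (b := u.proj)
    (by simpa using mem_tchart_source.1 hu) v

theorem constSec_dfib (hu : u ∈ (tchart p).source) (v : PiFiber u) :
    constSec p (dfib p u v) u = v := by
  exact (trivializationAt E (TangentSpace 𝓘(ℝ, E)) p.proj).symmL_continuousLinearMapAt
    (R := ℝ) (b := u.proj)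
    (by simpa using mem_tchart_source.1 hu) v

instance : ContMDiffVectorBundle ∞ E (TangentSpace 𝓘(ℝ, E) : M → Type _) 𝓘(ℝ, E) :=
  haveI : IsManifold 𝓘(ℝ, E) (∞ + 1) M := by simpa
  TangentBundle.contMDiffVectorBundle (n := ∞)

instance contMDiffVectorBundle_piFiber : ContMDiffVectorBundle ∞ E
    ((proj E M) *ᵖ (TangentSpace 𝓘(ℝ, E) : M → Type _)) 𝓘(ℝ, E).tangent :=
  ContMDiffVectorBundle.pullback E (TangentSpace 𝓘(ℝ, E) : M → Type _) _ (proj E M)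

theorem trivializationAt_piFiber_apply (hu : u ∈ (tchart p).source) (w : PiFiber u) :
    (trivializationAt E (PiFiber (M := M)) p (TotalSpace.mk' E u w)).2 = dfib p u w := by
  have h1 := mem_tchart_source.1 hu
  exact ((trivializationAt E (TangentSpace 𝓘(ℝ, E)) p.proj).continuousLinearMapAt_apply_of_mem
    (R := ℝ) (b := u.proj) (by simpa using h1) w).symm

theorem mem_trivializationAt_piFiber_baseSet (hu : u ∈ (tchart p).source) :
    u ∈ (trivializationAt E (PiFiber (M := M)) p).baseSet := by
  exact mem_tchart_source.1 hu

theorem tchart_source_mem_nhds (hu : u ∈ (tchart p).source) : (tchart p).source ∈ 𝓝 u :=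
  (isOpen_extChartAt_source p).mem_nhds hu

theorem mdifferentiableAt_sec_iff (hu : u ∈ (tchart p).source)
    (Y : Π u : TangentBundle 𝓘(ℝ, E) M, PiFiber u) :
    MDifferentiableAt (𝓘(ℝ, E).tangent) ((𝓘(ℝ, E).tangent).prod 𝓘(ℝ, E))
      (fun v => TotalSpace.mk' E v (Y v)) u ↔ MDifferentiableAt (𝓘(ℝ, E).tangent) 𝓘(ℝ, E)
        (fun v => dfib p v (Y v)) u := by
  rw [(trivializationAt E (PiFiber (M := M)) p).mdifferentiableAt_section_iff
    (𝓘(ℝ, E).tangent) Y (mem_trivializationAt_piFiber_baseSet hu)]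
  apply Filter.EventuallyEq.mdifferentiableAt_iff
  filter_upwards [tchart_source_mem_nhds hu] with v hv
  exact trivializationAt_piFiber_apply hv _

theorem smoothSecAt_iff (hu : u ∈ (tchart p).source)
    (Y : Π u : TangentBundle 𝓘(ℝ, E) M, PiFiber u) :
    SmoothSecAt Y u ↔ ContMDiffAt (𝓘(ℝ, E).tangent) 𝓘(ℝ, E) ∞ (fun v => dfib p v (Y v)) u := by
  rw [SmoothSecAt, (trivializationAt E (PiFiber (M := M)) p).contMDiffAt_section_iff
    (mem_trivializationAt_piFiber_baseSet hu)]
  apply Filter.EventuallyEq.contMDiffAt_iff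
  filter_upwards [tchart_source_mem_nhds hu] with v hv
  exact trivializationAt_piFiber_apply hv _

theorem smoothSecAt_constSec (hu : u ∈ (tchart p).source) (v : E) :
    SmoothSecAt (constSec p v) u := by
  rw [smoothSecAt_iff hu]
  refine (contMDiffAt_const (c := v)).congr_of_eventuallyEq ?_
  filter_upwards [tchart_source_mem_nhds hu] with w hw
  exact dfib_constSec hw v

theorem trivializationAt_tt_apply (hu : u ∈ (tchart p).source) (X : TT u) :
    (trivializationAt (E × E) (TangentSpace (𝓘(ℝ, E).tangent) : TangentBundle 𝓘(ℝ, E) M → _) p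
      ⟨u, X⟩).2 = dchart p u X := by
  have h1 : u ∈ (chartAt (ModelProd E E) p).source := by simpa [tchart] using hu
  have := TangentBundle.continuousLinearMapAt_trivializationAt (I := 𝓘(ℝ, E).tangent) h1
  rw [dchart, tchart, ← this]
  exact (Trivialization.continuousLinearMapAt_apply_of_mem (R := ℝ) _ (by simpa using h1) X).symm

theorem mdifferentiableAt_vf_iff (hu : u ∈ (tchart p).source)
    (X : Π u : TangentBundle 𝓘(ℝ, E) M, TT u) :
    MDifferentiableAt (𝓘(ℝ, E).tangent) (𝓘(ℝ, E).tangent).tangent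
      (fun v => (⟨v, X v⟩ : TangentBundle (𝓘(ℝ, E).tangent) (TangentBundle 𝓘(ℝ, E) M))) u ↔
        MDifferentiableAt (𝓘(ℝ, E).tangent) 𝓘(ℝ, E × E) (fun v => dchart p v (X v)) u := by
  have h1 : u ∈ (chartAt (ModelProd E E) p).source := by simpa [tchart] using hu
  have := (trivializationAt (E × E) (TangentSpace (𝓘(ℝ, E).tangent) : TangentBundle 𝓘(ℝ, E) M → _)
    p).mdifferentiableAt_section_iff
    (𝓘(ℝ, E).tangent) X (b₀ := u) (by simpa using h1)
  refine this.trans ?_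
  apply Filter.EventuallyEq.mdifferentiableAt_iff
  filter_upwards [tchart_source_mem_nhds hu] with v hv
  exact trivializationAt_tt_apply hv _

theorem smoothVFAt_iff (hu : u ∈ (tchart p).source)
    (X : Π u : TangentBundle 𝓘(ℝ, E) M, TT u) :
    SmoothVFAt X u ↔
      ContMDiffAt (𝓘(ℝ, E).tangent) 𝓘(ℝ, E × E) ∞ (fun v => dchart p v (X v)) u := by
  have h1 : u ∈ (chartAt (ModelProd E E) p).source := by simpa [tchart] using hu
  have := (trivializationAt (E × E) (TangentSpace (𝓘(ℝ, E).tangent) : TangentBundle 𝓘(ℝ, E) M → _)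
    p).contMDiffAt_section_iff (n := ∞) (IB := 𝓘(ℝ, E).tangent) (s := X) (x₀ := u)
    (by simpa using h1)
  refine this.trans ?_
  apply Filter.EventuallyEq.contMDiffAt_iff
  filter_upwards [tchart_source_mem_nhds hu] with v hv
  exact trivializationAt_tt_apply hv _

theorem dchart_comp_mfderiv_symm {z : E × E} (hz : z ∈ (tchart p).target) :
    (dchart p ((tchart p).symm z)).comp
      (mfderiv 𝓘(ℝ, E × E) (𝓘(ℝ, E).tangent) (tchart p).symm z) = .id ℝ (E × E) := by
  have := mfderiv_extChartAt_comp_mfderivWithin_extChartAt_symm (I := 𝓘(ℝ, E).tangent) hz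
  rwa [ModelWithCorners.range_eq_univ, mfderivWithin_univ] at this

theorem mfderiv_symm_comp_dchart {z : E × E} (hz : z ∈ (tchart p).target) :
    (mfderiv 𝓘(ℝ, E × E) (𝓘(ℝ, E).tangent) (tchart p).symm z).comp
      (dchart p ((tchart p).symm z)) = .id ℝ _ := by
  have := mfderivWithin_extChartAt_symm_comp_mfderiv_extChartAt (I := 𝓘(ℝ, E).tangent) hz
  rwa [ModelWithCorners.range_eq_univ, mfderivWithin_univ] at this

theorem mfderiv_symm_inverse {z : E × E} (hz : z ∈ (tchart p).target) :
    (mfderiv 𝓘(ℝ, E × E) (𝓘(ℝ, E).tangent) (tchart p).symm z).inverse =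
      dchart p ((tchart p).symm z) :=
  ContinuousLinearMap.inverse_eq (mfderiv_symm_comp_dchart hz) (dchart_comp_mfderiv_symm hz)

theorem isInvertible_dchart (hu : u ∈ (tchart p).source) : (dchart p u).IsInvertible :=
  isInvertible_mfderiv_extChartAt hu

theorem dchart_injective (hu : u ∈ (tchart p).source) : Function.Injective (dchart p u) := by
  obtain ⟨e, he⟩ := isInvertible_dchart hu
  rw [← he]
  exact e.injective

theorem dfib_injective (hu : u ∈ (tchart p).source) : Function.Injective (dfib p u) :=
  Function.LeftInverse.injective (g := fun v => constSec p v u) (constSec_dfib hu)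

/-- The local representative of a vector field in the bundle chart at `p`. -/
noncomputable def repVF (p : TangentBundle 𝓘(ℝ, E) M) (X : Π u : TangentBundle 𝓘(ℝ, E) M, TT u)
    (z : E × E) : E × E :=
  dchart p ((tchart p).symm z) (X ((tchart p).symm z))

/-- The local representative of a section of `π⁻¹(TM)` in the bundle chart at `p`. -/
noncomputable def repSec (p : TangentBundle 𝓘(ℝ, E) M)
    (Y : Π u : TangentBundle 𝓘(ℝ, E) M, PiFiber u) (z : E × E) : E :=
  dfib p ((tchart p).symm z) (Y ((tchart p).symm z))

theorem tchart_mem_target (hu : u ∈ (tchart p).source) : tchart p u ∈ (tchart p).target :=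
  (tchart p).map_source hu

theorem isOpen_tchart_target : IsOpen (tchart p).target := isOpen_extChartAt_target p

theorem contMDiffAt_tchart_symm {z : E × E} (hz : z ∈ (tchart p).target) :
    ContMDiffAt 𝓘(ℝ, E × E) (𝓘(ℝ, E).tangent) ∞ (tchart p).symm z :=
  (contMDiffOn_extChartAt_symm p).contMDiffAt (isOpen_tchart_target.mem_nhds hz)

theorem contMDiffAt_tchart (hu : u ∈ (tchart p).source) :
    ContMDiffAt (𝓘(ℝ, E).tangent) 𝓘(ℝ, E × E) ∞ (tchart p) u :=
  contMDiffAt_extChartAt' (by simpa [tchart] using hu)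

theorem mlieBracket_eq_lieBracket {F : Type*} [NormedAddCommGroup F] [NormedSpace ℝ F]
    (V W : Π x : F, TangentSpace 𝓘(ℝ, F) x) (x : F) :
    mlieBracket 𝓘(ℝ, F) V W x = lieBracket ℝ (V : F → F) W x := by
  rw [← mlieBracketWithin_univ]
  exact (congr_fun mlieBracketWithin_eq_lieBracketWithin x).trans
    (congr_fun (lieBracketWithin_univ (V := (V : F → F)) (W := W)) x)

/-- The Lie bracket is natural under pullback along the inverse chart, and near the point that
pullback of a field is its `repVF`. -/
theorem dchart_mlieBracket [FiniteDimensional ℝ E] (hu : u ∈ (tchart p).source)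
    {V W : Π u : TangentBundle 𝓘(ℝ, E) M, TT u}
    (hV : MDifferentiableAt (𝓘(ℝ, E).tangent) (𝓘(ℝ, E).tangent).tangent
      (fun v => (⟨v, V v⟩ : TangentBundle (𝓘(ℝ, E).tangent) (TangentBundle 𝓘(ℝ, E) M))) u)
    (hW : MDifferentiableAt (𝓘(ℝ, E).tangent) (𝓘(ℝ, E).tangent).tangent
      (fun v => (⟨v, W v⟩ : TangentBundle (𝓘(ℝ, E).tangent) (TangentBundle 𝓘(ℝ, E) M))) u) :
    dchart p u (mlieBracket (𝓘(ℝ, E).tangent) V W u) =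
      lieBracket ℝ (repVF p V) (repVF p W) (tchart p u) := by
  have hz := tchart_mem_target hu
  have hsu : (tchart p).symm (tchart p u) = u := (tchart p).left_inv hu
  have hrep : ∀ X : Π u : TangentBundle 𝓘(ℝ, E) M, TT u,
      mpullback 𝓘(ℝ, E × E) (𝓘(ℝ, E).tangent) (tchart p).symm X =ᶠ[𝓝 (tchart p u)] repVF p X := by
    intro X
    filter_upwards [isOpen_tchart_target.mem_nhds hz] with z hz
    rw [mpullback_apply, mfderiv_symm_inverse hz]
    rfl
  have : IsManifold (𝓘(ℝ, E).tangent) (minSmoothness ℝ 2) (TangentBundle 𝓘(ℝ, E) M) := by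
    rw [minSmoothness_of_isRCLikeNormedField]
    exact IsManifold.of_le (n := ∞) ENat.LEInfty.out
  have key := mpullback_mlieBracket (I := 𝓘(ℝ, E × E)) (I' := 𝓘(ℝ, E).tangent) (n := ∞)
    (f := (tchart p).symm) (x₀ := tchart p u) (V := V) (W := W) (by rwa [hsu]) (by rwa [hsu])
    (contMDiffAt_tchart_symm hz)
    (by rw [minSmoothness_of_isRCLikeNormedField]; exact ENat.LEInfty.out)
  rw [(hrep V).mlieBracket_vectorField_eq (hrep W), (hrep _).eq_of_nhds] at key
  refine Eq.trans ?_ (key.trans (mlieBracket_eq_lieBracket _ _ _))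
  rw [repVF, hsu]

theorem mdifferentiableAt_iff_comp_symm {F : Type*} [NormedAddCommGroup F] [NormedSpace ℝ F]
    (hu : u ∈ (tchart p).source) {f : TangentBundle 𝓘(ℝ, E) M → F} :
    MDifferentiableAt (𝓘(ℝ, E).tangent) 𝓘(ℝ, F) f u ↔
      DifferentiableAt ℝ (f ∘ (tchart p).symm) (tchart p u) := by
  have hsu : (tchart p).symm (tchart p u) = u := (tchart p).left_inv hu
  rw [← mdifferentiableAt_iff_differentiableAt]
  constructor
  · intro h
    exact MDifferentiableAt.comp _ (by rwa [hsu])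
      ((contMDiffAt_tchart_symm (tchart_mem_target hu)).mdifferentiableAt (by simp))
  · intro h
    refine (h.comp u (mdifferentiableAt_tchart hu)).congr_of_eventuallyEq ?_
    filter_upwards [tchart_source_mem_nhds hu] with v hv
    simp [(tchart p).left_inv hv]

theorem contMDiffAt_iff_comp_symm {F : Type*} [NormedAddCommGroup F] [NormedSpace ℝ F]
    (hu : u ∈ (tchart p).source) {f : TangentBundle 𝓘(ℝ, E) M → F} :
    ContMDiffAt (𝓘(ℝ, E).tangent) 𝓘(ℝ, F) ∞ f u ↔
      ContDiffAt ℝ ∞ (f ∘ (tchart p).symm) (tchart p u) := by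
  have hsu : (tchart p).symm (tchart p u) = u := (tchart p).left_inv hu
  rw [← contMDiffAt_iff_contDiffAt]
  constructor
  · intro h
    exact ContMDiffAt.comp _ (by rwa [hsu]) (contMDiffAt_tchart_symm (tchart_mem_target hu))
  · intro h
    refine (h.comp u (contMDiffAt_tchart hu)).congr_of_eventuallyEq ?_
    filter_upwards [tchart_source_mem_nhds hu] with v hv
    simp [(tchart p).left_inv hv]

theorem mvfderiv_eq_fderiv {F : Type*} [NormedAddCommGroup F] [NormedSpace ℝ F]
    (hu : u ∈ (tchart p).source) {f : TangentBundle 𝓘(ℝ, E) M → F}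
    (hf : MDifferentiableAt (𝓘(ℝ, E).tangent) 𝓘(ℝ, F) f u) (X : TT u) :
    mvfderiv (𝓘(ℝ, E).tangent) f u X =
      fderiv ℝ (f ∘ (tchart p).symm) (tchart p u) (dchart p u X) := by
  have h1 := ((mdifferentiableAt_iff_comp_symm hu).1 hf).hasFDerivAt.hasMFDerivAt
  have h2 := h1.comp u (mdifferentiableAt_tchart hu).hasMFDerivAt
  have h3 : f =ᶠ[𝓝 u] (f ∘ (tchart p).symm) ∘ (tchart p) := by
    filter_upwards [tchart_source_mem_nhds hu] with v hv
    simp [(tchart p).left_inv hv]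
  have h4 := (h2.congr_of_eventuallyEq h3).mfderiv
  exact congr($h4 X)

theorem repVF_gamma {z : E × E} (hz : z ∈ (tchart p).target)
    (Y : Π u : TangentBundle 𝓘(ℝ, E) M, PiFiber u) :
    repVF p (fun v => gamma v (Y v)) z = (0, repSec p Y z) :=
  dchart_gamma ((tchart p).map_target hz) _

theorem repSec_rho {z : E × E} (hz : z ∈ (tchart p).target)
    (X : Π u : TangentBundle 𝓘(ℝ, E) M, TT u) :
    repSec p (fun v => rho v (X v)) z = (repVF p X z).1 :=
  dfib_rho ((tchart p).map_target hz) _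

theorem repSec_eta {z : E × E} (hz : z ∈ (tchart p).target) : repSec p eta z = z.2 := by
  rw [repSec, ← tchart_snd_eq ((tchart p).map_target hz), (tchart p).right_inv hz]

theorem repSec_constSec {z : E × E} (hz : z ∈ (tchart p).target) (v : E) :
    repSec p (constSec p v) z = v :=
  dfib_constSec ((tchart p).map_target hz) v

end Chart

/-! ### Calculus of a local energy on `E × E`: Euler identities and the Koszul argument -/

section Analysis

variable {E : Type*} [NormedAddCommGroup E] [NormedSpace ℝ E]

theorem differentiableAt_clm_of_apply {F G : Type*} [NormedAddCommGroup F] [NormedSpace ℝ F]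
    [NormedAddCommGroup G] [NormedSpace ℝ G] [FiniteDimensional ℝ E] {f : F → E →L[ℝ] G} {z : F}
    (h : ∀ v, DifferentiableAt ℝ (fun x => f x v) z) : DifferentiableAt ℝ f z := by
  let d := Module.finrank ℝ E
  have hd : d = Module.finrank ℝ (Fin d → ℝ) := (Module.finrank_fin_fun ℝ).symm
  let e₁ := ContinuousLinearEquiv.ofFinrankEq hd
  let e₂ := (e₁.arrowCongr (1 : G ≃L[ℝ] G)).trans (ContinuousLinearEquiv.piRing (Fin d))
  rw [← Function.id_comp f, ← e₂.symm_comp_self]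
  exact e₂.symm.differentiableAt.comp z (differentiableAt_pi.mpr fun i => h _)

/-- A solution of a smooth invertible linear system depends smoothly on the parameter. -/
theorem differentiableAt_of_clm_apply_eq {F G : Type*} [NormedAddCommGroup F] [NormedSpace ℝ F]
    [NormedAddCommGroup G] [NormedSpace ℝ G] [CompleteSpace E] {k : F → E →L[ℝ] G} {h : F → E}
    {f : F → G} {z : F} (hk : DifferentiableAt ℝ k z) (hf : DifferentiableAt ℝ f z)
    (hinv : ∀ᶠ w in 𝓝 z, (k w).IsInvertible) (heq : ∀ᶠ w in 𝓝 z, k w (h w) = f w) :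
    DifferentiableAt ℝ h z := by
  obtain ⟨e, he⟩ := hinv.self_of_nhds
  have h1 : DifferentiableAt ℝ (fun w => (k w).inverse) z := by
    have h2 : ContDiffAt ℝ 1 ContinuousLinearMap.inverse (k z) := he ▸ contDiffAt_map_inverse e
    exact (h2.differentiableAt one_ne_zero).comp z hk
  refine (h1.clm_apply hf).congr_of_eventuallyEq ?_
  filter_upwards [hinv, heq] with w h3 h4
  rw [← h4]
  obtain ⟨e, he⟩ := h3
  simp [← he]

/-- The local representative of a Finsler energy near the point `z`: smooth and positively
homogeneous of degree two in the second variable. -/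
structure IsEnergyAt (e : E × E → ℝ) (z : E × E) : Prop where
  contDiffAt : ∀ᶠ w in 𝓝 z, ContDiffAt ℝ ∞ e w
  euler : ∀ᶠ w in 𝓝 z, fderiv ℝ e w (0, w.2) = 2 * e w

/-- The second derivative. -/
noncomputable def hess (e : E × E → ℝ) (w X Y : E × E) : ℝ := fderiv ℝ (fderiv ℝ e) w X Y

/-- The third derivative. -/
noncomputable def third (e : E × E → ℝ) (w X Y Z : E × E) : ℝ :=
  fderiv ℝ (fderiv ℝ (fderiv ℝ e)) w X Y Z

/-- The second derivative in the fibre directions. -/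
noncomputable def fmetric (e : E × E → ℝ) (w : E × E) (a b : E) : ℝ := hess e w (0, a) (0, b)

variable {e : E × E → ℝ} {z : E × E}

theorem contDiffAt_fderiv (h : ContDiffAt ℝ ∞ e z) : ContDiffAt ℝ ∞ (fderiv ℝ e) z :=
  h.fderiv_right (by simp)

theorem contDiffAt_hess (h : ContDiffAt ℝ ∞ e z) : ContDiffAt ℝ ∞ (fderiv ℝ (fderiv ℝ e)) z :=
  (contDiffAt_fderiv h).fderiv_right (by simp)

theorem hess_comm (h : ContDiffAt ℝ ∞ e z) (X Y : E × E) : hess e z X Y = hess e z Y X :=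
  (h.isSymmSndFDerivAt (by rw [minSmoothness_of_isRCLikeNormedField]; exact ENat.LEInfty.out)) X Y

theorem hess_add_left (X X' Y : E × E) : hess e z (X + X') Y = hess e z X Y + hess e z X' Y := by
  simp [hess]

theorem third_add (X X' Y Z : E × E) :
    third e z (X + X') Y Z = third e z X Y Z + third e z X' Y Z := by
  rw [third, ContinuousLinearMap.map_add]
  rfl

theorem hasFDerivAt_fderiv_apply (h : ContDiffAt ℝ ∞ e z) (Y : E × E) :
    HasFDerivAt (fun w => fderiv ℝ e w Y) ((fderiv ℝ (fderiv ℝ e) z).flip Y) z := by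
  have := ((contDiffAt_fderiv h).differentiableAt (by simp)).hasFDerivAt.clm_apply
    (hasFDerivAt_const Y z)
  simpa using this

theorem hasFDerivAt_hess (h : ContDiffAt ℝ ∞ e z) (X Y : E × E) :
    HasFDerivAt (fun w => hess e w X Y)
      (((fderiv ℝ (fderiv ℝ (fderiv ℝ e)) z).flip X).flip Y) z := by
  have := (((contDiffAt_hess h).differentiableAt (by simp)).hasFDerivAt.clm_apply
    (hasFDerivAt_const X z)).clm_apply (hasFDerivAt_const Y z)
  simpa [hess] using this

theorem third_comm_right (h : ∀ᶠ w in 𝓝 z, ContDiffAt ℝ ∞ e w) (X Y Z : E × E) :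
    third e z X Y Z = third e z X Z Y := by
  have h1 : (fun w => hess e w Y Z) =ᶠ[𝓝 z] fun w => hess e w Z Y := by
    filter_upwards [h] with w hw using hess_comm hw _ _
  have h2 := (hasFDerivAt_hess h.self_of_nhds Y Z).unique
    ((hasFDerivAt_hess h.self_of_nhds Z Y).congr_of_eventuallyEq h1)
  exact congr($h2 X)

theorem third_comm_left (h : ContDiffAt ℝ ∞ e z) (X Y Z : E × E) :
    third e z X Y Z = third e z Y X Z := by
  have := ((contDiffAt_fderiv h).isSymmSndFDerivAt
    (by rw [minSmoothness_of_isRCLikeNormedField]; exact ENat.LEInfty.out)) X Y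
  exact congr($this Z)

namespace IsEnergyAt

theorem eventually (h : IsEnergyAt e z) : ∀ᶠ w in 𝓝 z, IsEnergyAt e w := by
  filter_upwards [h.contDiffAt.eventually_nhds, h.euler.eventually_nhds] with w h1 h2
  exact ⟨h1, h2⟩

/-- This is the derivative of Euler's relation along `X`; the first-order term on the left comes
from the dependence of the radial direction on the point. -/
theorem hess_snd (h : IsEnergyAt e z) (X : E × E) :
    hess e z X (0, z.2) + fderiv ℝ e z (0, X.2) = 2 * fderiv ℝ e z X := by
  have h0 := h.contDiffAt.self_of_nhds
  have h1 : HasFDerivAt (fun w : E × E => ((0 : E), w.2))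
      ((0 : E × E →L[ℝ] E).prod (.snd ℝ E E)) z := (hasFDerivAt_const _ _).prodMk hasFDerivAt_snd
  have h2 := ((contDiffAt_fderiv h0).differentiableAt (by simp)).hasFDerivAt.clm_apply h1
  have h3 := (h0.differentiableAt (by simp)).hasFDerivAt.const_mul 2
  have h4 := h2.unique (h3.congr_of_eventuallyEq h.euler)
  have h5 := congr($h4 X)
  simp at h5
  rw [hess]
  linarith

theorem fmetric_snd (h : IsEnergyAt e z) (v : E) : fmetric e z z.2 v = fderiv ℝ e z (0, v) := by
  have := h.hess_snd (0, v)
  rw [fmetric, hess_comm h.contDiffAt.self_of_nhds]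
  linarith

theorem hess_fst_snd (h : IsEnergyAt e z) (a : E) :
    hess e z (a, 0) (0, z.2) = 2 * fderiv ℝ e z (a, 0) := by
  have := h.hess_snd (a, 0)
  simpa [← Prod.zero_eq_mk] using this

theorem fmetric_snd_snd (h : IsEnergyAt e z) : fmetric e z z.2 z.2 = 2 * e z := by
  rw [h.fmetric_snd, h.euler.self_of_nhds]

/-- Differentiate `fmetric_snd` along `X`: the motion of the radial vector cancels the vertical part
of `X`. For vertical `X` the result is zero, which is why the Cartan tensor annihilates the radial
direction. -/
theorem third_snd (h : IsEnergyAt e z) (X : E × E) (v : E) :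
    third e z X (0, z.2) (0, v) = hess e z (X.1, 0) (0, v) := by
  have h0 := h.contDiffAt.self_of_nhds
  have h1 : HasFDerivAt (fun w : E × E => ((0 : E), w.2))
      ((0 : E × E →L[ℝ] E).prod (.snd ℝ E E)) z := (hasFDerivAt_const _ _).prodMk hasFDerivAt_snd
  have h2 := (((contDiffAt_hess h0).differentiableAt (by simp)).hasFDerivAt.clm_apply h1).clm_apply
    (hasFDerivAt_const ((0 : E), v) z)
  have h3 : (fun w => fderiv ℝ (fderiv ℝ e) w (0, w.2) (0, v)) =ᶠ[𝓝 z]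
      fun w => fderiv ℝ e w (0, v) := by
    filter_upwards [h.eventually] with w hw using hw.fmetric_snd v
  have h4 := h2.unique ((hasFDerivAt_fderiv_apply h0 (0, v)).congr_of_eventuallyEq h3)
  have h5 := congr($h4 X)
  simp at h5
  have h6 := hess_add_left (e := e) (z := z) (X.1, 0) (0, X.2) (0, v)
  simp only [Prod.mk_add_mk, add_zero, zero_add, hess] at h6
  rw [third, hess]
  linarith

end IsEnergyAt

/-- The second derivative in the fibre directions, as a continuous bilinear form. -/
noncomputable def fmetricL (e : E × E → ℝ) (w : E × E) : E →L[ℝ] E →L[ℝ] ℝ :=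
  (fderiv ℝ (fderiv ℝ e) w).bilinearComp (.inr ℝ E E) (.inr ℝ E E)

theorem fmetricL_apply (e : E × E → ℝ) (w : E × E) (a b : E) :
    fmetricL e w a b = fmetric e w a b := rfl

theorem fmetric_comm (h : ContDiffAt ℝ ∞ e z) (a b : E) : fmetric e z a b = fmetric e z b a :=
  hess_comm h _ _

/-- The third derivative in the direction of the fibre, as a linear form. -/
noncomputable def thirdL (e : E × E → ℝ) (w : E × E) (i k : E) : E →L[ℝ] ℝ :=
  (((fderiv ℝ (fderiv ℝ (fderiv ℝ e)) w).flip (0, i)).flip (0, k)).comp (.inr ℝ E E)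

theorem thirdL_apply (e : E × E → ℝ) (w : E × E) (i k v : E) :
    thirdL e w i k v = third e w (0, v) (0, i) (0, k) := rfl

theorem third_split (a v i k : E) :
    third e z (a, v) (0, i) (0, k) = third e z (a, 0) (0, i) (0, k) + thirdL e z i k v := by
  rw [thirdL_apply, ← third_add, Prod.mk_add_mk, add_zero, zero_add]

theorem IsEnergyAt.thirdL_snd_left (h : IsEnergyAt e z) (k v : E) : thirdL e z z.2 k v = 0 := by
  rw [thirdL_apply, h.third_snd]
  simp [hess, ← Prod.zero_eq_mk]

theorem thirdL_comm (h : ∀ᶠ w in 𝓝 z, ContDiffAt ℝ ∞ e w) (i k v : E) :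
    thirdL e z i k v = thirdL e z k i v := third_comm_right h _ _ _

theorem thirdL_comm' (h : ContDiffAt ℝ ∞ e z) (i k v : E) :
    thirdL e z i k v = thirdL e z v k i := third_comm_left h _ _ _

theorem IsEnergyAt.thirdL_snd_right (h : IsEnergyAt e z) (k v : E) : thirdL e z k z.2 v = 0 := by
  rw [thirdL_comm h.contDiffAt, h.thirdL_snd_left]

theorem IsEnergyAt.thirdL_snd (h : IsEnergyAt e z) (i k : E) : thirdL e z i k z.2 = 0 := by
  rw [thirdL_comm' h.contDiffAt.self_of_nhds, h.thirdL_snd_left]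

/-- The equation of the vertical part of the canonical spray, differentiated along the fibre. -/
theorem IsEnergyAt.fderiv_spray (h : IsEnergyAt e z) {S : E × E → E} (hS : DifferentiableAt ℝ S z)
    (hSeq : ∀ᶠ w in 𝓝 z, ∀ k, fmetric e w (S w) k =
      fderiv ℝ e w (k, 0) - hess e w (w.2, 0) (0, k)) (i k : E) :
    fmetric e z (fderiv ℝ S z (0, i)) k = hess e z (0, i) (k, 0) - third e z (z.2, 0) (0, i) (0, k)
      - hess e z (i, 0) (0, k) - thirdL e z i k (S z) := by
  have h0 := h.contDiffAt.self_of_nhds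
  have hd := ((contDiffAt_hess h0).differentiableAt (by simp)).hasFDerivAt
  have h1 : HasFDerivAt (fun w : E × E => ((0 : E), S w))
      ((0 : E × E →L[ℝ] E).prod (fderiv ℝ S z)) z :=
    (hasFDerivAt_const _ _).prodMk hS.hasFDerivAt
  have h1' : HasFDerivAt (fun w : E × E => (w.2, (0 : E)))
      ((ContinuousLinearMap.snd ℝ E E).prod (0 : E × E →L[ℝ] E)) z :=
    hasFDerivAt_snd.prodMk (hasFDerivAt_const _ _)
  have h2 := (hd.clm_apply h1).clm_apply (hasFDerivAt_const ((0 : E), k) z)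
  have h2' := (hd.clm_apply h1').clm_apply (hasFDerivAt_const ((0 : E), k) z)
  have h3 := (hasFDerivAt_fderiv_apply h0 (k, 0)).sub h2'
  have h4 := h2.unique (h3.congr_of_eventuallyEq (by filter_upwards [hSeq] with w hw using hw k))
  have h5 := congr($h4 (0, i))
  simp at h5
  -- The derivative was taken in the direction `(0, i)`; symmetry of third derivatives moves `i`
  -- into the order used in the statement.
  have h6 := thirdL_comm' h0 i k (S z)
  have h7 := third_comm_left h0 (z.2, 0) (0, i) (0, k)
  simp only [thirdL_apply] at h6 ⊢
  rw [h6, h7]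
  simp only [fmetric, hess, third]
  linarith

/-- The pointwise linear algebra of a horizontally recurrent connection: the horizontal Christoffel
symbols `Γ` determine the horizontal lift `i ↦ (i, -N i)`. -/
structure IsRecurrentAt (e : E × E → ℝ) (z : E × E) (A : E → ℝ) (N : E → E) (Γ : E → E → E) :
    Prop where
  symm : ∀ i j, Γ i j = Γ j i
  snd : ∀ i, Γ i z.2 = N i
  recurrent : ∀ i j k, third e z (i, -N i) (0, j) (0, k) - fmetric e z (Γ i j) k
    - fmetric e z j (Γ i k) = A i * fmetric e z j k

/-- In `e1 + e2 - e3` the unknown pairings g(y, Γ(i, k)) and g(i, N k) cancel, leaving -2 g(N i, k).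
The radial vector occurs in each triple, so Euler's identities simplify the third derivatives, and
only the Cartan term with N y survives from the vertical parts of the lifts. -/
theorem IsRecurrentAt.koszul {A : E → ℝ} {N : E → E} {Γ : E → E → E} (h : IsRecurrentAt e z A N Γ)
    (hE : IsEnergyAt e z) (i k : E) :
    2 * fmetric e z (N i) k = hess e z (i, 0) (0, k) + third e z (z.2, 0) (0, i) (0, k)
      - thirdL e z i k (N z.2) - hess e z (k, 0) (0, i)
      - A i * fmetric e z z.2 k - A z.2 * fmetric e z i k + A k * fmetric e z i z.2 := by
  have h0 := hE.contDiffAt.self_of_nhds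
  have e1 := h.recurrent i z.2 k
  have e2 := h.recurrent z.2 i k
  have e3 := h.recurrent k i z.2
  rw [third_split, hE.third_snd, map_neg, hE.thirdL_snd_left, h.snd] at e1
  rw [third_split, map_neg, h.symm z.2 i, h.snd, h.symm z.2 k, h.snd] at e2
  rw [third_split, third_comm_right hE.contDiffAt, hE.third_snd, map_neg, hE.thirdL_snd_right,
    h.snd, h.symm k i, fmetric_comm h0 (Γ i k)] at e3
  simp only at e1 e2 e3
  rw [fmetric_comm h0 i z.2] at e3 ⊢
  linarith [fmetric_comm h0 i (N k)]

/-- Take `i` radial in `koszul`: the Cartan term drops out, so the right-hand side no longer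
contains `N`. The factor `e z` in front of `a` is half of g(y, y). -/
theorem IsRecurrentAt.semispray {A : E → ℝ} {N : E → E} {Γ : E → E → E}
    (h : IsRecurrentAt e z A N Γ) (hE : IsEnergyAt e z) {a s : E}
    (ha : ∀ k, fmetric e z a k = A k)
    (hs : ∀ k, fmetric e z s k = fderiv ℝ e z (k, 0) - hess e z (z.2, 0) (0, k))
    (hnd : ∀ v, (∀ k, fmetric e z v k = 0) → v = 0) :
    -N z.2 = s + A z.2 • z.2 - e z • a := by
  rw [← sub_eq_zero]
  refine hnd _ fun k => ?_
  have h1 := h.koszul hE z.2 k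
  rw [hE.thirdL_snd_left, ← hE.third_snd (z.2, 0) k, hE.fmetric_snd_snd, hE.third_snd,
    hE.hess_fst_snd] at h1
  simp only [← fmetricL_apply] at ha hs h1 ⊢
  simp only [map_add, map_sub, map_neg, map_smul, _root_.sub_apply,
    _root_.add_apply, _root_.neg_apply, _root_.smul_apply,
    smul_eq_mul, ha, hs]
  linarith

theorem IsRecurrentAt.nonlinear {A : E → ℝ} {N : E → E} {Γ : E → E → E}
    (h : IsRecurrentAt e z A N Γ) (hE : IsEnergyAt e z) {a i t : E} {S : E × E → E}
    (ha : ∀ k, fmetric e z a k = A k) (hS : DifferentiableAt ℝ S z)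
    (hSeq : ∀ᶠ w in 𝓝 z, ∀ k, fmetric e w (S w) k =
      fderiv ℝ e w (k, 0) - hess e w (w.2, 0) (0, k))
    (ht : ∀ k, 2 * fmetric e z t k = thirdL e z i k a)
    (hnd : ∀ v, (∀ k, fmetric e z v k = 0) → v = 0) :
    -(2 : ℝ) • N i = fderiv ℝ S z (0, i) + (A i • z.2 + A z.2 • i - fmetric e z i z.2 • a
      + (2 * e z) • t) := by
  have h0 := hE.contDiffAt.self_of_nhds
  rw [← sub_eq_zero]
  refine hnd _ fun k => ?_
  have h1 := h.koszul hE i k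
  have h2 := hE.fderiv_spray hS hSeq i k
  -- Insert the value of N y from `semispray` into the Cartan term of `koszul`: its radial part
  -- contributes nothing, its `S` part will cancel against `fderiv_spray`, and its `a` part is
  -- rewritten through `t`.
  have h3 : thirdL e z i k (N z.2) = _ :=
    congrArg (thirdL e z i k) (neg_eq_iff_eq_neg.1 (h.semispray hE ha hSeq.self_of_nhds hnd))
  simp only [map_add, map_sub, map_neg, map_smul, smul_eq_mul, hE.thirdL_snd, ← ht] at h3
  rw [h3] at h1
  rw [hess_comm h0 (0, i)] at h2
  simp only [← fmetricL_apply] at ha h1 h2 ⊢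
  simp only [map_add, map_sub, map_smul, _root_.sub_apply,
    _root_.add_apply, _root_.smul_apply,
    smul_eq_mul, ha, h2]
  linarith

end Analysis

/-! ### The Finsler energy and metric in a bundle chart -/

section EnergyChart

variable {E : Type*} [NormedAddCommGroup E] [NormedSpace ℝ E]
  {M : Type*} [TopologicalSpace M] [ChartedSpace E M] [IsManifold 𝓘(ℝ, E) ∞ M]
  {p u : TangentBundle 𝓘(ℝ, E) M} {L : TangentBundle 𝓘(ℝ, E) M → ℝ}

theorem mem_slit_iff (hu : u ∈ (tchart p).source) : u ∈ slit E M ↔ (tchart p u).2 ≠ 0 := by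
  rw [tchart_snd_eq hu, Ne, ← map_zero (dfib p u), (dfib_injective hu).eq_iff]
  rfl

theorem mem_tchart_source_self (p : TangentBundle 𝓘(ℝ, E) M) : p ∈ (tchart p).source :=
  mem_extChartAt_source p

/-- Openness of the slit bundle lets pointwise identities on it be differentiated. -/
theorem slit_mem_nhds (hu : u ∈ slit E M) : slit E M ∈ 𝓝 u := by
  have h1 := mem_tchart_source_self u
  have h2 : ContinuousAt (fun v => (tchart u v).2) u :=
    (contMDiffAt_tchart h1).continuousAt.snd
  filter_upwards [tchart_source_mem_nhds h1, h2.eventually_ne ((mem_slit_iff h1).1 hu)] with v h3 h4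
  exact (mem_slit_iff h3).2 h4

theorem eventually_tchart (hu : u ∈ (tchart p).source) {P : TangentBundle 𝓘(ℝ, E) M → Prop}
    (h : ∀ᶠ v in 𝓝 u, P v) :
    ∀ᶠ w in 𝓝 (tchart p u), w ∈ (tchart p).target ∧ P ((tchart p).symm w) := by
  have h1 : Filter.Tendsto (tchart p).symm (𝓝 (tchart p u)) (𝓝 u) := by
    have := (contMDiffAt_tchart_symm (tchart_mem_target hu)).continuousAt.tendsto
    rwa [(tchart p).left_inv hu] at this
  filter_upwards [isOpen_tchart_target.mem_nhds (tchart_mem_target hu), h1.eventually h] with w a b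
  exact ⟨a, b⟩

/-- The local representative of the energy in the bundle chart at `p`. -/
noncomputable def repEnergy (L : TangentBundle 𝓘(ℝ, E) M → ℝ) (p : TangentBundle 𝓘(ℝ, E) M) :
    E × E → ℝ :=
  energy L ∘ (tchart p).symm

theorem contMDiffAt_energy (hL : IsFinsler L) (hs : u ∈ slit E M) :
    ContMDiffAt (𝓘(ℝ, E).tangent) 𝓘(ℝ, ℝ) ∞ (energy L) u :=
  contMDiffAt_const.mul ((hL.smooth.contMDiffAt (slit_mem_nhds hs)).pow 2)

theorem contDiffAt_repEnergy (hL : IsFinsler L) (hu : u ∈ (tchart p).source) (hs : u ∈ slit E M) :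
    ContDiffAt ℝ ∞ (repEnergy L p) (tchart p u) :=
  (contMDiffAt_iff_comp_symm hu).1 (contMDiffAt_energy hL hs)

theorem repEnergy_tchart (hu : u ∈ (tchart p).source) :
    repEnergy L p (tchart p u) = energy L u := by
  rw [repEnergy, Function.comp_apply, (tchart p).left_inv hu]

theorem fibreIncl_mem_source (hu : u ∈ (tchart p).source) (y : E) :
    (fibreIncl u.proj y : TangentBundle 𝓘(ℝ, E) M) ∈ (tchart p).source :=
  mem_tchart_source.2 (mem_tchart_source.1 hu)

theorem repEnergy_smul (hL : IsFinsler L) (hu : u ∈ (tchart p).source) {c : ℝ} (hc : 0 < c) :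
    repEnergy L p ((tchart p u).1, c • (tchart p u).2) = c ^ 2 * repEnergy L p (tchart p u) := by
  have h1 := tchart_fibreIncl hu (c • fibreCoord u)
  have h2 := fibreIncl_mem_source hu (c • fibreCoord u)
  rw [map_smul] at h1
  have h3 : (tchart p u).2 = (show E →L[ℝ] E from dfib p u) (fibreCoord u) := tchart_snd_eq hu
  rw [← h3] at h1
  rw [← h1, repEnergy_tchart h2, repEnergy_tchart hu, energy, energy]
  have h4 : L (fibreIncl u.proj (c • fibreCoord u)) = c * L u := hL.homogeneous u.proj u.2 c hc
  rw [h4]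
  ring

theorem euler_repEnergy (hL : IsFinsler L) (hu : u ∈ (tchart p).source) (hs : u ∈ slit E M) :
    fderiv ℝ (repEnergy L p) (tchart p u) (0, (tchart p u).2) = 2 * repEnergy L p (tchart p u) := by
  set z := tchart p u with hz
  have h1 : HasDerivAt (fun c : ℝ => (z.1, c • z.2)) (0, z.2) 1 := by
    have := (hasDerivAt_const (1 : ℝ) z.1).prodMk ((hasDerivAt_id (1 : ℝ)).smul_const z.2)
    simpa using this
  have h2 : HasFDerivAt (repEnergy L p) (fderiv ℝ (repEnergy L p) z) (z.1, (1 : ℝ) • z.2) := by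
    rw [one_smul]
    exact ((contDiffAt_repEnergy hL hu hs).differentiableAt (by simp)).hasFDerivAt
  have h3 := h2.comp_hasDerivAt (1 : ℝ) h1
  have h4 : HasDerivAt (fun c : ℝ => c ^ 2 * repEnergy L p z) (2 * repEnergy L p z) 1 := by
    simpa using (hasDerivAt_pow 2 (1 : ℝ)).mul_const (repEnergy L p z)
  refine h3.unique (h4.congr_of_eventuallyEq ?_)
  -- Homogeneity holds for positive factors only, which is enough near 1.
  filter_upwards [lt_mem_nhds one_pos] with c hc
  exact repEnergy_smul hL hu hc

theorem isEnergyAt_repEnergy (hL : IsFinsler L) (hu : u ∈ (tchart p).source) (hs : u ∈ slit E M) :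
    IsEnergyAt (repEnergy L p) (tchart p u) := by
  have h := eventually_tchart hu (slit_mem_nhds hs)
  constructor
  · filter_upwards [h] with w hw
    have := contDiffAt_repEnergy hL ((tchart p).map_target hw.1) hw.2
    rwa [(tchart p).right_inv hw.1] at this
  · filter_upwards [h] with w hw
    have := euler_repEnergy hL ((tchart p).map_target hw.1) hw.2
    rwa [(tchart p).right_inv hw.1] at this

theorem fderiv_fderiv_comp_fibre {e : E × E → ℝ} {x y₀ : E} (d : E →L[ℝ] E)
    (h : ∀ᶠ w in 𝓝 (x, d y₀), ContDiffAt ℝ ∞ e w) (a b : E) :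
    fderiv ℝ (fderiv ℝ fun y => e (x, d y)) y₀ a b = fmetric e (x, d y₀) (d a) (d b) := by
  let i : E →L[ℝ] E × E := (ContinuousLinearMap.inr ℝ E E).comp d
  have h2 : ∀ y, HasFDerivAt (fun y => (x, d y)) i y := fun y =>
    (hasFDerivAt_const x y).prodMk d.hasFDerivAt
  have h4 : fderiv ℝ (fun y => e (x, d y)) =ᶠ[𝓝 y₀] fun y => (fderiv ℝ e (x, d y)).comp i := by
    filter_upwards [(h2 y₀).continuousAt.tendsto.eventually h] with y hy
    exact ((hy.differentiableAt (by simp)).hasFDerivAt.comp y (h2 y)).fderiv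
  have h6 := ((contDiffAt_fderiv h.self_of_nhds).differentiableAt (by simp)).hasFDerivAt
  have h7 := (h6.comp y₀ (h2 _)).clm_comp (hasFDerivAt_const i y₀)
  have h8 := (h7.congr_of_eventuallyEq h4).fderiv
  rw [h8]
  simp [fmetric, hess, i]

/-- The chart acts on the fibre by a linear map, and under a linear change of variables the Hessian
transforms as a bilinear form without first-order corrections. -/
theorem metric_eq_fmetric (hL : IsFinsler L) (hu : u ∈ (tchart p).source) (hs : u ∈ slit E M)
    (a b : PiFiber u) :
    metric L u a b = fmetric (repEnergy L p) (tchart p u) (dfib p u a) (dfib p u b) := by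
  let d : E →L[ℝ] E := dfib p u
  have h1 : (fun y : E => energy L (fibreIncl u.proj y)) =
      fun y => repEnergy L p ((tchart p u).1, d y) := by
    ext y
    exact (congrArg (repEnergy L p) (tchart_fibreIncl hu y)).symm.trans
      (repEnergy_tchart (fibreIncl_mem_source hu y)) |>.symm
  have h3 : ((tchart p u).1, d (fibreCoord u)) = tchart p u :=
    Prod.ext rfl (tchart_snd_eq hu).symm
  have h4 := fderiv_fderiv_comp_fibre (e := repEnergy L p) (x := (tchart p u).1)
    (y₀ := fibreCoord u) d (by rw [h3]; exact (isEnergyAt_repEnergy hL hu hs).contDiffAt) a b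
  rw [h3, ← h1] at h4
  exact h4

theorem mdifferentiableAt_energy (hL : IsFinsler L) (hs : u ∈ slit E M) :
    MDifferentiableAt (𝓘(ℝ, E).tangent) 𝓘(ℝ, ℝ) (energy L) u :=
  (contMDiffAt_energy hL hs).mdifferentiableAt (by simp)

theorem fmetric_nondegenerate (hL : IsFinsler L) (hu : u ∈ (tchart p).source) (hs : u ∈ slit E M)
    (v : E) (h : ∀ k, fmetric (repEnergy L p) (tchart p u) v k = 0) : v = 0 := by
  have h1 := hL.nondegenerate u hs (constSec p v u) fun w => by
    rw [metric_eq_fmetric hL hu hs, dfib_constSec hu, h]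
  rw [← dfib_constSec hu v, h1, map_zero]

end EnergyChart

/-! ### Connection forms, the horizontal map and `d_J E` in a bundle chart -/

section ConnectionChart

variable {E : Type*} [NormedAddCommGroup E] [NormedSpace ℝ E]
  {M : Type*} [TopologicalSpace M] [ChartedSpace E M] [IsManifold 𝓘(ℝ, E) ∞ M]
  {p u : TangentBundle 𝓘(ℝ, E) M} {L : TangentBundle 𝓘(ℝ, E) M → ℝ}

/-- The `π`-vector field `Y` is differentiable at `u`. -/
abbrev MDiffSecAt (Y : Π u : TangentBundle 𝓘(ℝ, E) M, PiFiber u)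
    (u : TangentBundle 𝓘(ℝ, E) M) : Prop :=
  MDifferentiableAt (𝓘(ℝ, E).tangent) ((𝓘(ℝ, E).tangent).prod 𝓘(ℝ, E))
    (fun v => TotalSpace.mk' E v (Y v)) u

/-- The vector field `X` on `TM` is differentiable at `u`. -/
abbrev MDiffVFAt (X : Π u : TangentBundle 𝓘(ℝ, E) M, TT u)
    (u : TangentBundle 𝓘(ℝ, E) M) : Prop :=
  MDifferentiableAt (𝓘(ℝ, E).tangent) (𝓘(ℝ, E).tangent).tangent
    (fun v => (⟨v, X v⟩ : TangentBundle (𝓘(ℝ, E).tangent) (TangentBundle 𝓘(ℝ, E) M))) u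

theorem SmoothSecAt.mdiffSecAt {Y : Π u : TangentBundle 𝓘(ℝ, E) M, PiFiber u}
    (h : SmoothSecAt Y u) : MDiffSecAt Y u :=
  ContMDiffAt.mdifferentiableAt h (by simp)

theorem SmoothVFAt.mdiffVFAt {X : Π u : TangentBundle 𝓘(ℝ, E) M, TT u}
    (h : SmoothVFAt X u) : MDiffVFAt X u :=
  ContMDiffAt.mdifferentiableAt h (by simp)

theorem mdiffSecAt_iff (hu : u ∈ (tchart p).source)
    {Y : Π u : TangentBundle 𝓘(ℝ, E) M, PiFiber u} :
    MDiffSecAt Y u ↔ DifferentiableAt ℝ (repSec p Y) (tchart p u) :=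
  (mdifferentiableAt_sec_iff hu Y).trans (mdifferentiableAt_iff_comp_symm hu)

theorem mdiffVFAt_iff (hu : u ∈ (tchart p).source)
    {X : Π u : TangentBundle 𝓘(ℝ, E) M, TT u} :
    MDiffVFAt X u ↔ DifferentiableAt ℝ (repVF p X) (tchart p u) :=
  (mdifferentiableAt_vf_iff hu X).trans (mdifferentiableAt_iff_comp_symm hu)

theorem repVF_tchart (hu : u ∈ (tchart p).source)
    (X : Π u : TangentBundle 𝓘(ℝ, E) M, TT u) :
    repVF p X (tchart p u) = dchart p u (X u) := by
  rw [repVF, (tchart p).left_inv hu]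

/-- The flat connection of the bundle chart at `p`. -/
noncomputable def flatConn (p : TangentBundle 𝓘(ℝ, E) M) : Conn E M := fun Y u =>
  ((trivializationAt E (TangentSpace 𝓘(ℝ, E)) p.proj).symmL ℝ u.proj : E →L[ℝ] PiFiber u).comp
    (mvfderiv (𝓘(ℝ, E).tangent) (fun v => dfib p v (Y v)) u)

theorem dfib_flatConn (hu : u ∈ (tchart p).source)
    (Y : Π u : TangentBundle 𝓘(ℝ, E) M, PiFiber u) (X : TT u) :
    dfib p u (flatConn p Y u X) = mvfderiv (𝓘(ℝ, E).tangent) (fun v => dfib p v (Y v)) u X :=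
  dfib_constSec hu _

theorem isCovariantDerivativeOn_flatConn (p : TangentBundle 𝓘(ℝ, E) M) :
    IsCovariantDerivativeOn E (flatConn p) (tchart p).source where
  add {Y Z u} hY hZ hu := by
    ext X
    apply dfib_injective hu
    rw [dfib_flatConn hu]
    have h1 := mvfderiv_add ((mdifferentiableAt_sec_iff hu Y).1 hY)
      ((mdifferentiableAt_sec_iff hu Z).1 hZ)
    have h2 : (fun v => dfib p v ((Y + Z) v)) =
      (fun v => dfib p v (Y v)) + fun v => dfib p v (Z v) := by ext v; simp
    rw [h2, h1, _root_.add_apply, _root_.add_apply, map_add, dfib_flatConn hu, dfib_flatConn hu]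
  leibniz {Y f u} hY hf hu := by
    ext X
    apply dfib_injective hu
    rw [dfib_flatConn hu]
    have h1 := mvfderiv_smul hf ((mdifferentiableAt_sec_iff hu Y).1 hY)
    have h2 : (fun v => dfib p v ((f • Y) v)) = f • (fun v => dfib p v (Y v)) := by ext v; simp
    rw [h2, h1]
    simp [dfib_flatConn hu]

/-- The connection form of `D` in the bundle chart at `p`: the representative of `D_X` applied to
the constant section `v`. -/
noncomputable def connForm (D : Conn E M) (p u : TangentBundle 𝓘(ℝ, E) M) (X : TT u) (v : E) : E :=
  dfib p u (D (constSec p v) u X)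

/-- The difference of `D` and the flat connection of the chart is tensorial, so it may be evaluated
on the constant section through `Y u`, which the flat connection annihilates. -/
theorem dfib_conn [FiniteDimensional ℝ E] {D : Conn E M} (hD : IsRegular D)
    (hu : u ∈ (tchart p).source) (hs : u ∈ slit E M)
    {Y : Π u : TangentBundle 𝓘(ℝ, E) M, PiFiber u} (hY : MDiffSecAt Y u) (X : TT u) :
    dfib p u (D Y u X) = fderiv ℝ (repSec p Y) (tchart p u) (dchart p u X) +
      connForm D p u X (dfib p u (Y u)) := by
  have hd := hD.isCovariantDerivativeOn.mono (s := slit E M ∩ (tchart p).source) inter_subset_left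
  have hf := (isCovariantDerivativeOn_flatConn p).mono (s := slit E M ∩ (tchart p).source)
    inter_subset_right
  have hc := (smoothSecAt_constSec hu (dfib p u (Y u))).mdiffSecAt
  have h1 := hd.difference_apply hf ⟨hs, hu⟩ hY
  have h2 := hd.difference_apply hf ⟨hs, hu⟩ hc
  rw [constSec_dfib hu, h1] at h2
  have h3 := congr(dfib p u ($h2 X))
  have h4 : fderiv ℝ (repSec p (constSec p (dfib p u (Y u)))) (tchart p u) = 0 := by
    have : repSec p (constSec p (dfib p u (Y u))) =ᶠ[𝓝 (tchart p u)] fun _ => dfib p u (Y u) := by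
      filter_upwards [isOpen_tchart_target.mem_nhds (tchart_mem_target hu)] with w hw
      exact repSec_constSec hw _
    rw [this.fderiv_eq]
    simp
  have h5 : ∀ {Z}, MDiffSecAt Z u → dfib p u (flatConn p Z u X) =
      fderiv ℝ (repSec p Z) (tchart p u) (dchart p u X) := fun {Z} hZ => by
    rw [dfib_flatConn hu, mvfderiv_eq_fderiv hu ((mdifferentiableAt_sec_iff hu Z).1 hZ)]
    rfl
  rw [_root_.sub_apply, _root_.sub_apply, map_sub, map_sub, h5 hY, h5 hc, h4] at h3
  simp only [_root_.zero_apply, sub_zero] at h3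
  rw [connForm, ← h3]
  abel

/-- The coordinate vector field `a` of the bundle chart at `p`. -/
noncomputable def constVF (p : TangentBundle 𝓘(ℝ, E) M) (a : E × E)
    (u : TangentBundle 𝓘(ℝ, E) M) : TT u :=
  (dchart p u).inverse a

theorem dchart_constVF (hu : u ∈ (tchart p).source) (a : E × E) :
    dchart p u (constVF p a u) = a := by
  obtain ⟨e, he⟩ := isInvertible_dchart hu
  simp [constVF, ← he]

theorem constVF_dchart (hu : u ∈ (tchart p).source) (X : TT u) :
    constVF p (dchart p u X) u = X :=
  dchart_injective hu (dchart_constVF hu _)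

theorem repVF_constVF {z : E × E} (hz : z ∈ (tchart p).target) (a : E × E) :
    repVF p (constVF p a) z = a :=
  dchart_constVF ((tchart p).map_target hz) a

theorem smoothVFAt_constVF (hu : u ∈ (tchart p).source) (a : E × E) :
    SmoothVFAt (constVF p a) u := by
  rw [smoothVFAt_iff hu]
  refine (contMDiffAt_const (c := a)).congr_of_eventuallyEq ?_
  filter_upwards [tchart_source_mem_nhds hu] with w hw
  exact dchart_constVF hw a

theorem rho_surjective (u : TangentBundle 𝓘(ℝ, E) M) : Function.Surjective (rho u) := fun w => by
  have hu := mem_tchart_source_self u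
  refine ⟨constVF u (dfib u u w, 0) u, dfib_injective hu ?_⟩
  rw [dfib_rho hu, dchart_constVF hu]

theorem rho_gamma (u : TangentBundle 𝓘(ℝ, E) M) (w : PiFiber u) : rho u (gamma u w) = 0 := by
  have hu := mem_tchart_source_self u
  apply dfib_injective hu
  rw [dfib_rho hu, dchart_gamma hu, map_zero]

theorem gamma_injective (u : TangentBundle 𝓘(ℝ, E) M) : Function.Injective (gamma u) := by
  have hu := mem_tchart_source_self u
  intro v w h
  have := congrArg (fun X => (dchart u u X).2) h
  simp only [dchart_gamma hu] at this
  exact dfib_injective hu this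

instance [FiniteDimensional ℝ E] (u : TangentBundle 𝓘(ℝ, E) M) : FiniteDimensional ℝ (TT u) :=
  inferInstanceAs (FiniteDimensional ℝ (E × E))

instance (u : TangentBundle 𝓘(ℝ, E) M) : T2Space (TT u) := inferInstanceAs (T2Space (E × E))

instance (u : TangentBundle 𝓘(ℝ, E) M) : T2Space (PiFiber u) := inferInstanceAs (T2Space E)

theorem isInvertible_of_bijective {V W : Type*} [AddCommGroup V] [Module ℝ V] [TopologicalSpace V]
    [IsTopologicalAddGroup V] [ContinuousSMul ℝ V] [T2Space V] [FiniteDimensional ℝ V]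
    [AddCommGroup W] [Module ℝ W] [TopologicalSpace W] [IsTopologicalAddGroup W]
    [ContinuousSMul ℝ W] [T2Space W] (f : V →L[ℝ] W) (hf : Function.Bijective f) :
    f.IsInvertible :=
  ⟨(LinearEquiv.ofBijective f.toLinearMap hf).toContinuousLinearEquiv, by ext; rfl⟩

/-- `hmap` is built from `ContinuousLinearMap.inverse`, which is zero on non-invertible maps;
regularity rules out this default value on the slit bundle. -/
theorem isInvertible_rho_ker [FiniteDimensional ℝ E] {D : Conn E M} (hD : IsRegular D)
    (hs : u ∈ slit E M) :
    ((rho u).comp (LinearMap.ker (connMap D u).toLinearMap).subtypeL).IsInvertible := by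
  have h := hD.isCompl u hs
  apply isInvertible_of_bijective
  constructor
  · rw [injective_iff_map_eq_zero]
    rintro ⟨X, hX⟩ h1
    have h2 : X ∈ LinearMap.ker (rho u).toLinearMap ⊓ LinearMap.ker (connMap D u).toLinearMap :=
      ⟨h1, hX⟩
    rw [h.inf_eq_bot, Submodule.mem_bot] at h2
    exact Subtype.ext h2
  · intro w
    obtain ⟨X, hX⟩ := rho_surjective u w
    have h1 : X ∈ LinearMap.ker (rho u).toLinearMap ⊔ LinearMap.ker (connMap D u).toLinearMap := by
      rw [h.sup_eq_top]
      trivial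
    obtain ⟨Y, hY, Z, hZ, rfl⟩ := Submodule.mem_sup.1 h1
    refine ⟨⟨Z, hZ⟩, ?_⟩
    have h2 : rho u Y = 0 := hY
    rw [map_add, h2, zero_add] at hX
    exact hX

theorem rho_hmap [FiniteDimensional ℝ E] {D : Conn E M} (hD : IsRegular D)
    (hs : u ∈ slit E M) (v : PiFiber u) : rho u (hmap D u v) = v := by
  obtain ⟨e, he⟩ := isInvertible_rho_ker hD hs
  have : ((rho u).comp (LinearMap.ker (connMap D u).toLinearMap).subtypeL)
      (((rho u).comp (LinearMap.ker (connMap D u).toLinearMap).subtypeL).inverse v) = v := by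
    rw [← he]
    simp
  exact this

theorem connMap_hmap (D : Conn E M) (u : TangentBundle 𝓘(ℝ, E) M) (v : PiFiber u) :
    connMap D u (hmap D u v) = 0 :=
  (((rho u).comp (LinearMap.ker (connMap D u).toLinearMap).subtypeL).inverse v).2

theorem connMap_gamma_injective {D : Conn E M} (hD : IsRegular D) (hs : u ∈ slit E M) :
    Function.Injective fun v => connMap D u (gamma u v) := by
  intro v w h
  have h2 : gamma u v - gamma u w ∈
      LinearMap.ker (rho u).toLinearMap ⊓ LinearMap.ker (connMap D u).toLinearMap :=
    ⟨by simp [rho_gamma], by simpa [sub_eq_zero] using h⟩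
  rw [(hD.isCompl u hs).inf_eq_bot, Submodule.mem_bot, sub_eq_zero] at h2
  exact gamma_injective u h2

theorem dchart_hmap [FiniteDimensional ℝ E] {D : Conn E M} (hD : IsRegular D)
    (hu : u ∈ (tchart p).source) (hs : u ∈ slit E M) (v : PiFiber u) :
    (dchart p u (hmap D u v)).1 = dfib p u v := by
  rw [← dfib_rho hu, rho_hmap hD hs]

theorem smoothSecAt_eta (u : TangentBundle 𝓘(ℝ, E) M) : SmoothSecAt eta u := by
  have hu := mem_tchart_source_self u
  rw [smoothSecAt_iff hu, contMDiffAt_iff_comp_symm hu]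
  refine (contDiffAt_snd).congr_of_eventuallyEq ?_
  filter_upwards [isOpen_tchart_target.mem_nhds (tchart_mem_target hu)] with w hw
  exact repSec_eta hw

theorem smoothSecAt_connMap {D : Conn E M} (hD : IsRegular D) (hs : u ∈ slit E M)
    {X : Π u : TangentBundle 𝓘(ℝ, E) M, TT u} (hX : SmoothVFAt X u) :
    SmoothSecAt (fun v => connMap D v (X v)) u := by
  have h1 := (hD.smooth.contMDiff (σ := eta)
    fun v _ => (by simpa using (smoothSecAt_eta v).contMDiffWithinAt)).contMDiffAt
      (slit_mem_nhds hs)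
  exact h1.clm_bundle_apply hX

/-- The connection map in the bundle chart at `p`, at a point of the target of the chart. -/
noncomputable def repConnMap (D : Conn E M) (p : TangentBundle 𝓘(ℝ, E) M) (z : E × E) :
    E × E →L[ℝ] E :=
  ((dfib p ((tchart p).symm z)).comp (connMap D ((tchart p).symm z))).comp
    (dchart p ((tchart p).symm z)).inverse

theorem repConnMap_repVF (D : Conn E M) {z : E × E} (hz : z ∈ (tchart p).target)
    (X : Π u : TangentBundle 𝓘(ℝ, E) M, TT u) :
    repConnMap D p z (repVF p X z) = repSec p (fun v => connMap D v (X v)) z :=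
  congrArg (fun Y => dfib p ((tchart p).symm z) (connMap D ((tchart p).symm z) Y))
    (constVF_dchart ((tchart p).map_target hz) _)

theorem differentiableAt_repConnMap [FiniteDimensional ℝ E] {D : Conn E M} (hD : IsRegular D)
    (hu : u ∈ (tchart p).source) (hs : u ∈ slit E M) :
    DifferentiableAt ℝ (repConnMap D p) (tchart p u) := by
  refine differentiableAt_clm_of_apply fun a => ?_
  refine ((mdiffSecAt_iff hu).1 (smoothSecAt_connMap hD hs
    (smoothVFAt_constVF hu a)).mdiffSecAt)

/-- The torsions contain brackets of horizontal lifts, so these lifts must be differentiable. The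
base component of the lift is that of `Y`; the vertical component h solves the linear system K(0, h)
= -K(Y, 0), whose coefficients are differentiable and whose operator, K on vertical vectors, is
invertible by regularity. -/
theorem mdiffVFAt_hmap [FiniteDimensional ℝ E] {D : Conn E M} (hD : IsRegular D)
    (hs : u ∈ slit E M) {Y : Π u : TangentBundle 𝓘(ℝ, E) M, PiFiber u} (hY : MDiffSecAt Y u) :
    MDiffVFAt (fun v => hmap D v (Y v)) u := by
  have hu := mem_tchart_source_self u
  rw [mdiffVFAt_iff hu]
  have hY' := (mdiffSecAt_iff hu).1 hY
  have hk := differentiableAt_repConnMap hD hu hs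
  have hev := eventually_tchart hu (slit_mem_nhds hs)
  have h1 : ∀ᶠ w in 𝓝 (tchart u u), (repVF u (fun v => hmap D v (Y v)) w).1 = repSec u Y w := by
    filter_upwards [hev] with w hw
    exact dchart_hmap hD ((tchart u).map_target hw.1) hw.2 _
  have h2 : DifferentiableAt ℝ (fun w => (repVF u (fun v => hmap D v (Y v)) w).2) (tchart u u) := by
    refine differentiableAt_of_clm_apply_eq
      (k := fun w => (repConnMap D u w).comp (.inr ℝ E E))
      (f := fun w => -repConnMap D u w (repSec u Y w, 0)) ?_ ?_ ?_ ?_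
    · exact hk.clm_comp (differentiableAt_const _)
    · exact (hk.clm_apply (hY'.prodMk (differentiableAt_const _))).neg
    · filter_upwards [hev] with w hw
      have hw' := (tchart u).map_target hw.1
      have h3 : Function.Injective ((repConnMap D u w).comp (.inr ℝ E E)) := by
        have h4 : ∀ a : E, (repConnMap D u w).comp (.inr ℝ E E) a =
            dfib u _ (connMap D _ (gamma _ (constSec u a ((tchart u).symm w)))) := fun a => by
          have := repConnMap_repVF D hw.1 (fun v => gamma v (constSec u a v))
          rwa [repVF_gamma hw.1, repSec_constSec hw.1] at this
        intro a b hab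
        rw [h4, h4] at hab
        have := connMap_gamma_injective hD hw.2 (dfib_injective hw' hab)
        rw [← dfib_constSec hw' a, ← dfib_constSec hw' b, this]
      exact isInvertible_of_bijective _ ⟨h3, LinearMap.injective_iff_surjective.1 h3⟩
    · filter_upwards [hev, h1] with w hw h5
      have h6 := repConnMap_repVF D hw.1 (fun v => hmap D v (Y v))
      have h7 : repSec u (fun v => connMap D v (hmap D v (Y v))) w = 0 := by
        simp [repSec, connMap_hmap]
      rw [h7] at h6
      rw [← h5, eq_neg_iff_add_eq_zero]
      refine Eq.trans ?_ h6
      simp only [ContinuousLinearMap.comp_apply, ContinuousLinearMap.inr_apply]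
      rw [← map_add, Prod.mk_add_mk, zero_add, add_zero]
  exact (hY'.congr_of_eventuallyEq h1).prodMk h2

theorem repSec_rho_eventuallyEq (hu : u ∈ (tchart p).source)
    (X : Π u : TangentBundle 𝓘(ℝ, E) M, TT u) :
    repSec p (fun v => rho v (X v)) =ᶠ[𝓝 (tchart p u)] fun w => (repVF p X w).1 := by
  filter_upwards [isOpen_tchart_target.mem_nhds (tchart_mem_target hu)] with w hw
  exact repSec_rho hw X

theorem mdiffSecAt_rho {X : Π u : TangentBundle 𝓘(ℝ, E) M, TT u} (hX : MDiffVFAt X u) :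
    MDiffSecAt (fun v => rho v (X v)) u := by
  have hu := mem_tchart_source_self u
  rw [mdiffSecAt_iff hu]
  exact ((mdiffVFAt_iff hu).1 hX).fst.congr_of_eventuallyEq (repSec_rho_eventuallyEq hu X)

theorem mdiffVFAt_gamma {Y : Π u : TangentBundle 𝓘(ℝ, E) M, PiFiber u} (hY : MDiffSecAt Y u) :
    MDiffVFAt (fun v => gamma v (Y v)) u := by
  have hu := mem_tchart_source_self u
  rw [mdiffVFAt_iff hu]
  refine ((differentiableAt_const (0 : E)).prodMk ((mdiffSecAt_iff hu).1 hY)).congr_of_eventuallyEq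
    ?_
  filter_upwards [isOpen_tchart_target.mem_nhds (tchart_mem_target hu)] with w hw
  exact repVF_gamma hw Y

theorem dchart_J (hu : u ∈ (tchart p).source) (X : TT u) :
    dchart p u (J u X) = (0, (dchart p u X).1) := by
  rw [← dfib_rho hu]
  exact dchart_gamma hu _

/-- On constant sections the metric coefficients are second derivatives of the local energy, and `D`
acts through its connection form alone. -/
theorem covMetric_constSec {D : Conn E M} (hL : IsFinsler L) (hu : u ∈ (tchart p).source)
    (hs : u ∈ slit E M) (X : TT u) (a b : E) :
    covMetric L D u X (constSec p a) (constSec p b) =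
      third (repEnergy L p) (tchart p u) (dchart p u X) (0, a) (0, b)
        - fmetric (repEnergy L p) (tchart p u) (connForm D p u X a) b
        - fmetric (repEnergy L p) (tchart p u) a (connForm D p u X b) := by
  have hE := (isEnergyAt_repEnergy hL hu hs).contDiffAt.self_of_nhds
  have h1 : (fun v => metric L v (constSec p a v) (constSec p b v)) ∘ (tchart p).symm
      =ᶠ[𝓝 (tchart p u)] fun w => hess (repEnergy L p) w (0, a) (0, b) := by
    filter_upwards [eventually_tchart hu (slit_mem_nhds hs)] with w hw
    have hw' := (tchart p).map_target hw.1
    rw [Function.comp_apply, metric_eq_fmetric hL hw' hw.2, dfib_constSec hw', dfib_constSec hw',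
      (tchart p).right_inv hw.1, fmetric]
  have h2 := (hasFDerivAt_hess hE (0, a) (0, b)).congr_of_eventuallyEq h1
  rw [covMetric, mvfderiv_eq_fderiv hu ((mdifferentiableAt_iff_comp_symm hu).2 h2.differentiableAt),
    h2.fderiv, metric_eq_fmetric hL hu hs, metric_eq_fmetric hL hu hs, dfib_constSec hu,
    dfib_constSec hu]
  rfl

/-- The representative of a form on `π⁻¹(TM)` in the bundle chart at `p`. -/
noncomputable def repForm (p : TangentBundle 𝓘(ℝ, E) M)
    (A : Π u : TangentBundle 𝓘(ℝ, E) M, PiFiber u →L[ℝ] ℝ) (z : E × E) : E →L[ℝ] ℝ :=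
  (A ((tchart p).symm z)).comp
    ((trivializationAt E (TangentSpace 𝓘(ℝ, E)) p.proj).symmL ℝ ((tchart p).symm z).proj)

theorem IsCartan.isHRF {D : Conn E M} (hD : IsCartan L D) : IsHRF L 0 D where
  regular := hD.regular
  recurrent u hs X Y Z hY hZ := by
    rw [hD.metrical u hs _ Y Z hY hZ]
    simp
  verticallyParallel u hs X Y Z hY hZ := hD.metrical u hs _ Y Z hY hZ
  hhTorsion := hD.hhTorsion
  hvTorsion := hD.hvTorsion

theorem connForm_zero {D : Conn E M} (hD : IsRegular D) (hs : u ∈ slit E M) (X : TT u) :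
    connForm D p u X 0 = 0 := by
  have h1 : (constSec p 0 : Π u : TangentBundle 𝓘(ℝ, E) M, PiFiber u) = 0 :=
    funext fun u => map_zero
      ((trivializationAt E (TangentSpace 𝓘(ℝ, E)) p.proj).symmL ℝ u.proj)
  rw [connForm, h1, hD.isCovariantDerivativeOn.zero hs]
  simp

theorem dJEnergy_eq (hL : IsFinsler L) (hu : u ∈ (tchart p).source) (hs : u ∈ slit E M) (X : TT u) :
    dJEnergy L u X = fderiv ℝ (repEnergy L p) (tchart p u) (0, (dchart p u X).1) := by
  rw [dJEnergy, mvfderiv_eq_fderiv hu (mdifferentiableAt_energy hL hs), dchart_J hu]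
  rfl

theorem mvfderiv_dJEnergy (hL : IsFinsler L) (hu : u ∈ (tchart p).source) (hs : u ∈ slit E M)
    {Y : Π u : TangentBundle 𝓘(ℝ, E) M, TT u} (hY : MDiffVFAt Y u) (X : TT u) :
    mvfderiv (𝓘(ℝ, E).tangent) (fun v => dJEnergy L v (Y v)) u X =
      hess (repEnergy L p) (tchart p u) (dchart p u X) (0, (dchart p u (Y u)).1) +
      fderiv ℝ (repEnergy L p) (tchart p u)
        (0, (fderiv ℝ (repVF p Y) (tchart p u) (dchart p u X)).1) := by
  have hE := (isEnergyAt_repEnergy hL hu hs).contDiffAt.self_of_nhds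
  have h1 : (fun v => dJEnergy L v (Y v)) ∘ (tchart p).symm =ᶠ[𝓝 (tchart p u)]
      fun w => fderiv ℝ (repEnergy L p) w (0, (repVF p Y w).1) := by
    filter_upwards [eventually_tchart hu (slit_mem_nhds hs)] with w hw
    rw [Function.comp_apply, dJEnergy_eq hL ((tchart p).map_target hw.1) hw.2,
      (tchart p).right_inv hw.1, repVF]
  have h2 := ((contDiffAt_fderiv hE).differentiableAt (by simp)).hasFDerivAt.clm_apply
    ((hasFDerivAt_const (0 : E) _).prodMk ((mdiffVFAt_iff hu).1 hY).hasFDerivAt.fst)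
  have h3 := h2.congr_of_eventuallyEq h1
  rw [mvfderiv_eq_fderiv hu ((mdifferentiableAt_iff_comp_symm hu).2 h3.differentiableAt), h3.fderiv,
    ← repVF_tchart hu Y]
  simp [hess, add_comm]

end ConnectionChart

/-! ### Torsions in a bundle chart and the resulting recurrence data -/

section TorsionChart

variable {E : Type*} [NormedAddCommGroup E] [NormedSpace ℝ E] [FiniteDimensional ℝ E]
  {M : Type*} [TopologicalSpace M] [ChartedSpace E M] [IsManifold 𝓘(ℝ, E) ∞ M]
  {p u : TangentBundle 𝓘(ℝ, E) M} {L : TangentBundle 𝓘(ℝ, E) M → ℝ} {D : Conn E M}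

/-- The derivatives of the base components of `V` and `W` cancel against the base component of the
bracket, so only the connection form remains. -/
theorem dfib_torsion (hD : IsRegular D) (hu : u ∈ (tchart p).source) (hs : u ∈ slit E M)
    {V W : Π u : TangentBundle 𝓘(ℝ, E) M, TT u} (hV : MDiffVFAt V u) (hW : MDiffVFAt W u) :
    dfib p u (torsion D V W u) = connForm D p u (V u) (dchart p u (W u)).1 -
      connForm D p u (W u) (dchart p u (V u)).1 := by
  have h1 : ∀ {X : Π u : TangentBundle 𝓘(ℝ, E) M, TT u} (hX : MDiffVFAt X u) (a : E × E),
      fderiv ℝ (repSec p fun v => rho v (X v)) (tchart p u) a =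
        (fderiv ℝ (repVF p X) (tchart p u) a).1 := fun {X} hX a => by
    rw [(repSec_rho_eventuallyEq hu X).fderiv_eq,
      (((mdiffVFAt_iff hu).1 hX).hasFDerivAt.fst).fderiv]
    rfl
  rw [torsion, map_sub, map_sub, dfib_conn hD hu hs (mdiffSecAt_rho hW),
    dfib_conn hD hu hs (mdiffSecAt_rho hV), h1 hV, h1 hW, dfib_rho hu, dfib_rho hu, dfib_rho hu,
    dchart_mlieBracket hu hV hW, lieBracket, repVF_tchart hu, repVF_tchart hu, Prod.fst_sub]
  abel

/-- A vertical vector has no base component, so only one of the two terms of `dfib_torsion`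
survives, and the vertical part of the horizontal lift plays no role. -/
theorem dfib_hvTorsion (hD : IsRegular D) (hu : u ∈ (tchart p).source) (hs : u ∈ slit E M)
    {X Y : Π u : TangentBundle 𝓘(ℝ, E) M, PiFiber u} (hX : MDiffSecAt X u) (hY : MDiffSecAt Y u) :
    dfib p u (hvTorsion D X Y u) = connForm D p u (gamma u (X u)) (dfib p u (Y u)) := by
  rw [hvTorsion, dfib_torsion hD hu hs (mdiffVFAt_gamma hX) (mdiffVFAt_hmap hD hs hY),
    dchart_gamma hu, dchart_hmap hD hu hs, connForm_zero hD hs, sub_zero]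

theorem dfib_hhTorsion (hD : IsRegular D) (hu : u ∈ (tchart p).source) (hs : u ∈ slit E M)
    {X Y : Π u : TangentBundle 𝓘(ℝ, E) M, PiFiber u} (hX : MDiffSecAt X u) (hY : MDiffSecAt Y u) :
    dfib p u (hhTorsion D X Y u) = connForm D p u (hmap D u (X u)) (dfib p u (Y u)) -
      connForm D p u (hmap D u (Y u)) (dfib p u (X u)) := by
  rw [hhTorsion, dfib_torsion hD hu hs (mdiffVFAt_hmap hD hs hX) (mdiffVFAt_hmap hD hs hY),
    dchart_hmap hD hu hs, dchart_hmap hD hu hs]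

/-- By vertical metricity the third fibre derivative is a sum of two pairings of the metric with the
connection form, and torsion symmetry makes these equal. Thus the (h)hv-torsion is the Cartan
tensor; the argument is applied to the Cartan connection. -/
theorem connForm_gamma_of_metrical (hL : IsFinsler L) (hD : IsRegular D) (hT : HVTorsionSymm L D)
    (hv : ∀ u ∈ slit E M, ∀ (X : PiFiber u) (Y Z), SmoothSecAt Y u → SmoothSecAt Z u →
      covMetric L D u (gamma u X) Y Z = 0)
    (hu : u ∈ (tchart p).source) (hs : u ∈ slit E M) (X : PiFiber u) (i k : E) :
    2 * fmetric (repEnergy L p) (tchart p u) (connForm D p u (gamma u X) i) k =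
      thirdL (repEnergy L p) (tchart p u) i k (dfib p u X) := by
  have hE := (isEnergyAt_repEnergy hL hu hs).contDiffAt.self_of_nhds
  have hc := fun a => smoothSecAt_constSec (p := p) hu a
  have h1 := hv u hs X _ _ (hc i) (hc k)
  rw [covMetric_constSec hL hu hs, dchart_gamma hu] at h1
  have h2 := hT u hs _ _ _ (hc (dfib p u X)) (hc i) (hc k)
  rw [metric_eq_fmetric hL hu hs, metric_eq_fmetric hL hu hs,
    dfib_hvTorsion hD hu hs (hc _).mdiffSecAt (hc _).mdiffSecAt,
    dfib_hvTorsion hD hu hs (hc _).mdiffSecAt (hc _).mdiffSecAt, constSec_dfib hu,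
    dfib_constSec hu, dfib_constSec hu] at h2
  rw [thirdL_apply]
  rw [fmetric_comm hE i] at h1
  linarith

/-- Horizontal vectors annihilate η, and η is represented by the coordinate y, whose derivative
along a vector is its vertical component. -/
theorem dchart_hmap_snd (hD : IsRegular D) (hu : u ∈ (tchart p).source) (hs : u ∈ slit E M)
    (v : PiFiber u) :
    connForm D p u (hmap D u v) (tchart p u).2 = -(dchart p u (hmap D u v)).2 := by
  have h1 := dfib_conn hD hu hs (smoothSecAt_eta u).mdiffSecAt (hmap D u v)
  have h2 : D eta u (hmap D u v) = 0 := connMap_hmap D u v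
  have h3 : repSec p eta =ᶠ[𝓝 (tchart p u)] Prod.snd := by
    filter_upwards [isOpen_tchart_target.mem_nhds (tchart_mem_target hu)] with w hw
    exact repSec_eta hw
  rw [h2, map_zero, h3.fderiv_eq, fderiv_snd, ← tchart_snd_eq hu] at h1
  exact eq_neg_of_add_eq_zero_right h1.symm

theorem IsHRF.isRecurrentAt {A : Π u : TangentBundle 𝓘(ℝ, E) M, PiFiber u →L[ℝ] ℝ}
    (hL : IsFinsler L) (hD : IsHRF L A D) (hu : u ∈ (tchart p).source) (hs : u ∈ slit E M) :
    IsRecurrentAt (repEnergy L p) (tchart p u) (fun i => A u (constSec p i u))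
      (fun i => -(dchart p u (hmap D u (constSec p i u))).2)
      (fun i j => connForm D p u (hmap D u (constSec p i u)) j) where
  symm i j := by
    have hc := fun a => smoothSecAt_constSec (p := p) hu a
    have h1 := dfib_hhTorsion hD.regular hu hs (hc i).mdiffSecAt (hc j).mdiffSecAt
    rw [hD.hhTorsion u hs _ _ (hc i) (hc j), map_zero, dfib_constSec hu, dfib_constSec hu] at h1
    exact (sub_eq_zero.1 h1.symm)
  snd i := dchart_hmap_snd hD.regular hu hs _
  recurrent i j k := by
    have hc := fun a => smoothSecAt_constSec (p := p) hu a
    have h1 := hD.recurrent u hs (constSec p i u) _ _ (hc j) (hc k)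
    -- `N` is minus the vertical component of the lift, hence the double negation.
    have h2 : dchart p u (hmap D u (constSec p i u)) =
        (i, - -(dchart p u (hmap D u (constSec p i u))).2) := by
      rw [neg_neg]
      exact Prod.ext ((dchart_hmap hD.regular hu hs _).trans (dfib_constSec hu i)) rfl
    rw [covMetric_constSec hL hu hs, metric_eq_fmetric hL hu hs, dfib_constSec hu,
      dfib_constSec hu] at h1
    rw [← h2]
    exact h1

end TorsionChart

/-! ### The canonical spray and the Barthel connection in a bundle chart -/

section SprayChart

variable {E : Type*} [NormedAddCommGroup E] [NormedSpace ℝ E] [FiniteDimensional ℝ E]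
  {M : Type*} [TopologicalSpace M] [ChartedSpace E M] [IsManifold 𝓘(ℝ, E) ∞ M]
  {p u : TangentBundle 𝓘(ℝ, E) M} {L : TangentBundle 𝓘(ℝ, E) M → ℝ}
  {G : Π u : TangentBundle 𝓘(ℝ, E) M, TT u}

/-- Against a coordinate field, the derivative of `G` in the second term cancels the one in the
bracket, so `Omega` depends on `G u` only. -/
theorem Omega_constVF (hL : IsFinsler L) (hu : u ∈ (tchart p).source) (hs : u ∈ slit E M)
    (hG : MDiffVFAt G u) (a : E × E) :
    Omega L G (constVF p a) u =
      hess (repEnergy L p) (tchart p u) (dchart p u (G u)) (0, a.1) -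
      hess (repEnergy L p) (tchart p u) a (0, (dchart p u (G u)).1) := by
  have hc := (smoothVFAt_constVF hu a).mdiffVFAt
  have h1 : fderiv ℝ (repVF p (constVF p a)) (tchart p u) = 0 := by
    have : repVF p (constVF p a) =ᶠ[𝓝 (tchart p u)] fun _ => a := by
      filter_upwards [isOpen_tchart_target.mem_nhds (tchart_mem_target hu)] with w hw
      exact repVF_constVF hw _
    rw [this.fderiv_eq]
    simp
  rw [Omega, mvfderiv_dJEnergy hL hu hs hc, mvfderiv_dJEnergy hL hu hs hG, dJEnergy_eq hL hu hs,
    dchart_mlieBracket hu hG hc, lieBracket, h1, dchart_constVF hu, repVF_tchart hu,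
    repVF_tchart hu, dchart_constVF hu]
  have h2 : ((0 : E), (0 - (fderiv ℝ (repVF p G) (tchart p u)) a).1) =
    -(0, ((fderiv ℝ (repVF p G) (tchart p u)) a).1) := by simp
  simp only [_root_.zero_apply]
  rw [h2, map_neg]
  simp only [map_zero, Prod.fst_zero, ← Prod.zero_eq_mk]
  ring

theorem IsCanonicalSpray.hess_sub_hess (hL : IsFinsler L) (hG : IsCanonicalSpray L G)
    (hu : u ∈ (tchart p).source) (hs : u ∈ slit E M) (a : E × E) :
    hess (repEnergy L p) (tchart p u) (dchart p u (G u)) (0, a.1) -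
      hess (repEnergy L p) (tchart p u) a (0, (dchart p u (G u)).1) =
        -fderiv ℝ (repEnergy L p) (tchart p u) a := by
  rw [← Omega_constVF hL hu hs (hG.smooth u hs).mdiffVFAt,
    hG.eq u hs _ (smoothVFAt_constVF hu a),
    mvfderiv_eq_fderiv hu (mdifferentiableAt_energy hL hs), dchart_constVF hu]
  rfl

/-- Test the spray equation on vertical vectors: the base component of `G` and y then have the same
pairing with every vector, by Euler, and nondegeneracy concludes. -/
theorem IsCanonicalSpray.dchart_fst (hL : IsFinsler L) (hG : IsCanonicalSpray L G)
    (hu : u ∈ (tchart p).source) (hs : u ∈ slit E M) :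
    (dchart p u (G u)).1 = (tchart p u).2 := by
  have hE := isEnergyAt_repEnergy hL hu hs
  rw [← sub_eq_zero]
  refine fmetric_nondegenerate hL hu hs _ fun k => ?_
  have h1 := hG.hess_sub_hess hL hu hs (0, k)
  have h2 := hE.fmetric_snd k
  rw [fmetric_comm hE.contDiffAt.self_of_nhds] at h2
  rw [fmetric_comm hE.contDiffAt.self_of_nhds, ← fmetricL_apply, map_sub, fmetricL_apply,
    fmetricL_apply, h2]
  simp only [← Prod.zero_eq_mk] at h1
  rw [show hess (repEnergy L p) (tchart p u) (dchart p u (G u)) 0 = 0 by simp [hess]] at h1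
  rw [fmetric]
  linarith

/-- Test the spray equation on base directions of the chart; this is the Euler–Lagrange equation for
the vertical component S. -/
theorem IsCanonicalSpray.fmetric_snd (hL : IsFinsler L) (hG : IsCanonicalSpray L G)
    (hu : u ∈ (tchart p).source) (hs : u ∈ slit E M) (k : E) :
    fmetric (repEnergy L p) (tchart p u) (dchart p u (G u)).2 k =
      fderiv ℝ (repEnergy L p) (tchart p u) (k, 0) -
        hess (repEnergy L p) (tchart p u) ((tchart p u).2, 0) (0, k) := by
  have hE := isEnergyAt_repEnergy hL hu hs
  have h1 := hG.hess_sub_hess hL hu hs (k, 0)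
  have h2 := hG.dchart_fst hL hu hs
  have h3 : dchart p u (G u) = ((tchart p u).2, 0) + (0, (dchart p u (G u)).2) := by
    ext <;> simp [h2]
  rw [h3, hess_add_left] at h1
  simp only [Prod.fst_add, add_zero, hE.hess_fst_snd] at h1
  rw [fmetric]
  linarith

/-- The Barthel connection in a bundle chart. -/
theorem IsCanonicalSpray.dchart_barthel (hL : IsFinsler L) (hG : IsCanonicalSpray L G)
    (hu : u ∈ (tchart p).source) (hs : u ∈ slit E M)
    {X : Π u : TangentBundle 𝓘(ℝ, E) M, TT u} (hX : MDiffVFAt X u) :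
    dchart p u (barthel G X u) = ((dchart p u (X u)).1,
      fderiv ℝ (fun w => (repVF p G w).2) (tchart p u) (0, (dchart p u (X u)).1) -
        (dchart p u (X u)).2) := by
  have hG' := (hG.smooth u hs).mdiffVFAt
  have hGd := (mdiffVFAt_iff hu).1 hG'
  have hXd := ((mdiffVFAt_iff hu).1 hX).hasFDerivAt
  have hJ : MDiffVFAt (fun v => J v (X v)) u := mdiffVFAt_gamma (mdiffSecAt_rho hX)
  have h1 : repVF p (fun v => J v (X v)) =ᶠ[𝓝 (tchart p u)] fun w => (0, (repVF p X w).1) := by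
    filter_upwards [isOpen_tchart_target.mem_nhds (tchart_mem_target hu)] with w hw
    exact dchart_J ((tchart p).map_target hw) _
  -- The brackets differentiate `G`, so its base component must be known on a whole neighbourhood.
  -- Afterwards the derivatives of `X` along `G` cancel between the two brackets.
  have h2 : repVF p G =ᶠ[𝓝 (tchart p u)] fun w => (w.2, (repVF p G w).2) := by
    filter_upwards [eventually_tchart hu (slit_mem_nhds hs)] with w hw
    refine Prod.ext ?_ rfl
    exact (hG.dchart_fst hL ((tchart p).map_target hw.1) hw.2).trans
      (by rw [(tchart p).right_inv hw.1])
  have h3 := (((hasFDerivAt_const (0 : E) _).prodMk hXd.fst).congr_of_eventuallyEq h1).fderiv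
  have h4 := ((hasFDerivAt_snd.prodMk hGd.snd.hasFDerivAt).congr_of_eventuallyEq h2).fderiv
  rw [barthel, map_sub, dchart_J hu, dchart_mlieBracket hu hJ hG', dchart_mlieBracket hu hX hG',
    lieBracket, lieBracket, repVF_tchart hu, repVF_tchart hu, repVF_tchart hu, dchart_J hu, h3, h4]
  ext <;> simp

end SprayChart

/-! ### The section dual to the recurrence form -/

section Sharp

variable {E : Type*} [NormedAddCommGroup E] [NormedSpace ℝ E] [FiniteDimensional ℝ E]
  {M : Type*} [TopologicalSpace M] [ChartedSpace E M] [IsManifold 𝓘(ℝ, E) ∞ M]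
  {p u : TangentBundle 𝓘(ℝ, E) M} {L : TangentBundle 𝓘(ℝ, E) M → ℝ}
  {A : Π u : TangentBundle 𝓘(ℝ, E) M, PiFiber u →L[ℝ] ℝ}

/-- A nondegenerate bilinear form on a finite-dimensional space is invertible. -/
theorem isInvertible_of_nondegenerate (B : E →L[ℝ] E →L[ℝ] ℝ)
    (h : ∀ v, (∀ w, B v w = 0) → v = 0) : B.IsInvertible := by
  have h1 : Function.Injective B := by
    rw [injective_iff_map_eq_zero]
    intro v hv
    exact h v fun w => by rw [hv]; rfl
  have h2 : Module.finrank ℝ E = Module.finrank ℝ (E →L[ℝ] ℝ) := by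
    rw [← (LinearMap.toContinuousLinearMap (𝕜 := ℝ) (E := E) (F' := ℝ)).finrank_eq]
    exact Subspace.dual_finrank_eq.symm
  exact isInvertible_of_bijective _
    ⟨h1, (LinearMap.injective_iff_surjective_of_finrank_eq_finrank h2).1 h1⟩

theorem metric_sharp (hL : IsFinsler L) (hs : u ∈ slit E M) (v : PiFiber u) :
    metric L u (sharp L A u) v = A u v := by
  have h1 : metric L u ((metric L u).inverse (A u)) = A u :=
    (isInvertible_of_nondegenerate (show E →L[ℝ] E →L[ℝ] ℝ from metric L u)
      (hL.nondegenerate u hs)).self_apply_inverse (A u)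
  exact congr($h1 v)

theorem fmetric_sharp (hL : IsFinsler L) (hu : u ∈ (tchart p).source) (hs : u ∈ slit E M) (k : E) :
    fmetric (repEnergy L p) (tchart p u) (dfib p u (sharp L A u)) k = A u (constSec p k u) := by
  rw [← metric_sharp hL hs, metric_eq_fmetric hL hu hs, dfib_constSec hu]

/-- Needed because `sharp L A` is fed as a section into the torsion of the Cartan connection. It
solves a linear system whose operator is the metric. -/
theorem mdiffSecAt_sharp (hL : IsFinsler L) (hA : IsPiOneForm A) (hs : u ∈ slit E M) :
    MDiffSecAt (sharp L A) u := by
  have hu := mem_tchart_source_self u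
  have hE := (isEnergyAt_repEnergy hL hu hs).contDiffAt.self_of_nhds
  have hev := eventually_tchart hu (slit_mem_nhds hs)
  rw [mdiffSecAt_iff hu]
  refine differentiableAt_of_clm_apply_eq (k := fmetricL (repEnergy L u)) (f := repForm u A)
    ?_ ?_ ?_ ?_
  · exact differentiableAt_clm_of_apply fun a => differentiableAt_clm_of_apply fun b =>
      (hasFDerivAt_hess hE (0, a) (0, b)).differentiableAt
  · exact differentiableAt_clm_of_apply fun k => (mdifferentiableAt_iff_comp_symm hu).1
      ((hA u hs _ (smoothSecAt_constSec hu k)).mdifferentiableAt (by simp))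
  · filter_upwards [hev] with w hw
    refine isInvertible_of_nondegenerate _ fun v hv => ?_
    refine fmetric_nondegenerate hL ((tchart u).map_target hw.1) hw.2 v ?_
    rwa [(tchart u).right_inv hw.1]
  · filter_upwards [hev] with w hw
    ext k
    have := fmetric_sharp (A := A) hL ((tchart u).map_target hw.1) hw.2 k
    rwa [(tchart u).right_inv hw.1] at this

end Sharp

end FinslerPullback

/-! ### The two formulas, read off in the chart centred at `u` -/

open FinslerPullback in
theorem mainTheorem3 {E : Type*} [NormedAddCommGroup E] [NormedSpace ℝ E] [FiniteDimensional ℝ E]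
    {M : Type*} [TopologicalSpace M] [ChartedSpace E M] [IsManifold 𝓘(ℝ, E) ∞ M]
    (L : TangentBundle 𝓘(ℝ, E) M → ℝ) (hL : IsFinsler L)
    (G : Π u : TangentBundle 𝓘(ℝ, E) M, TT u) (hG : IsCanonicalSpray L G)
    (nabla : Conn E M) (hnabla : IsCartan L nabla)
    (A : Π u : TangentBundle 𝓘(ℝ, E) M, PiFiber u →L[ℝ] ℝ) (hA : IsPiOneForm A)
    (D : Conn E M) (hD : IsHRF L A D) :
    (∀ u ∈ slit E M,
      assocSpray D u = G u + A u (eta u) • liouville u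
        - (1 / 2 * L u ^ 2) • gamma u (sharp L A u)) ∧
    (∀ (X : Π u : TangentBundle 𝓘(ℝ, E) M, TT u), ∀ u ∈ slit E M, SmoothVFAt X u →
      assocNonlinear D u (X u) = barthel G X u
        + (A u (rho u (X u)) • liouville u + A u (eta u) • J u (X u)
          - metric L u (rho u (X u)) (eta u) • gamma u (sharp L A u)
          + (L u ^ 2) • gamma u (hvTorsion nabla (sharp L A) (fun v => rho v (X v)) u))) := by
  constructor
  · intro u hs
    have hu := mem_tchart_source_self u
    have hE := isEnergyAt_repEnergy hL hu hs
    have h1 := (hD.isRecurrentAt hL hu hs).semispray hE (fmetric_sharp hL hu hs)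
      (hG.fmetric_snd hL hu hs) (fmetric_nondegenerate hL hu hs)
    have h2 : constSec u (tchart u u).2 u = eta u := by
      rw [tchart_snd_eq hu, constSec_dfib hu]
    rw [h2, neg_neg, repEnergy_tchart hu, energy] at h1
    apply dchart_injective hu
    rw [assocSpray, map_sub, map_add, map_smul, map_smul, liouville, dchart_gamma hu,
      dchart_gamma hu, ← tchart_snd_eq hu]
    ext
    · rw [dchart_hmap hD.regular hu hs, ← tchart_snd_eq hu]
      simp [hG.dchart_fst hL hu hs]
    · rw [h1]
      simp
  · intro X u hs hX
    have hu := mem_tchart_source_self u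
    have hE := isEnergyAt_repEnergy hL hu hs
    have hXd := hX.mdiffVFAt
    have hGd := ((mdiffVFAt_iff hu).1 (hG.smooth u hs).mdiffVFAt).snd
    have hspray : ∀ᶠ w in 𝓝 (tchart u u), ∀ k,
        fmetric (repEnergy L u) w (repVF u G w).2 k =
          fderiv ℝ (repEnergy L u) w (k, 0) - hess (repEnergy L u) w (w.2, 0) (0, k) := by
      filter_upwards [eventually_tchart hu (slit_mem_nhds hs)] with w hw k
      have := hG.fmetric_snd hL ((tchart u).map_target hw.1) hw.2 k
      rwa [(tchart u).right_inv hw.1] at this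
    -- The vector `t` of `nonlinear` is the representative of T(a, ρX) for the Cartan connection.
    have hT := fun k => connForm_gamma_of_metrical hL hnabla.regular hnabla.hvTorsion
      hnabla.isHRF.verticallyParallel hu hs (sharp L A u) (dchart u u (X u)).1 k
    have h1 := (hD.isRecurrentAt hL hu hs).nonlinear hE (fmetric_sharp hL hu hs) hGd hspray hT
      (fmetric_nondegenerate hL hu hs)
    have h2 : constSec u (tchart u u).2 u = eta u := by
      rw [tchart_snd_eq hu, constSec_dfib hu]
    have h3 : constSec u (dchart u u (X u)).1 u = rho u (X u) := by
      rw [← dfib_rho hu, constSec_dfib hu]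
    have h4 : 2 * energy L u = L u ^ 2 := by rw [energy]; ring
    rw [h2, h3, repEnergy_tchart hu, h4, smul_neg, neg_smul, neg_neg] at h1
    apply dchart_injective hu
    simp only [map_add, map_sub, map_smul]
    rw [hG.dchart_barthel hL hu hs hXd, liouville, dchart_gamma hu, dchart_gamma hu,
      dchart_gamma hu, dchart_J hu, dfib_hvTorsion hnabla.regular hu hs (mdiffSecAt_sharp hL hA hs)
        (mdiffSecAt_rho hXd), ← tchart_snd_eq hu, dfib_rho hu, metric_eq_fmetric hL hu hs,
      dfib_rho hu, ← tchart_snd_eq hu]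
    have h5 : dchart u u (assocNonlinear D u (X u)) =
        (2 : ℝ) • dchart u u (hmap D u (rho u (X u))) - dchart u u (X u) := by
      simp [assocNonlinear]
    rw [h5]
    -- The base components agree because 2β∘ρ - I and the Barthel connection both fix them; in the
    -- vertical components both sides contain minus that of `X`, and the rest is `h1`.
    ext
    · simp only [Prod.fst_sub, Prod.smul_fst, dchart_hmap hD.regular hu hs, dfib_rho hu]
      simp [two_smul]
    · simp only [Prod.snd_sub, Prod.smul_snd, h1]
      simp
      abel
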